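/- Let $n\geqslant 1$, $\kappa\geqslant 1$ and $m\geqslant 0$ be integers. Consider polynomials ${\sf P}(j^\kappa f)$ with complex coefficients in the jet variables $f_i^{(\lambda)}$ ($1\leqslant i\leqslant n$, $1\leqslant\lambda\leqslant\kappa$). Such a polynomial is called a bi-invariant of weight $m$ if (i) it is invariant by reparametrization with weight $m$: ${\sf P}\big(j^\kappa(f\circ\phi)\big)=\phi'(0)^m\,{\sf P}\big(j^\kappa f\big)$ at the origin, for all germs at $0$ of holomorphic maps $f=(f_1,\dots,f_n):\mathbb{C}\to\mathbb{C}^n$ and all germs of biholomorphisms $\phi$ of $(\mathbb{C},0)$; and (ii) it is invariant under the unipotent action: ${\sf P}({\sf u}\cdot j^\kappa f)={\sf P}(j^\kappa f)$ for every lower triangular matrix ${\sf u}\in{\sf GL}_n(\mathbb{C})$ with all diagonal entries equal to $1$, where $({\sf u}\cdot f^{(\lambda)})_i=\sum_j u_{ij}f_j^{(\lambda)}$ at each level $\lambda$. Let ${\sf D}=\sum_{k=1}^n\sum_{\lambda\geqslant 0} f_k^{(\lambda+1)}\,\partial/\partial f_k^{(\lambda)}$ be the total differentiation operator and, for ${\sf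 P}$ of weight $p$ and ${\sf Q}$ of weight $q$, put $[{\sf P},{\sf Q}]:=q\,{\sf D}{\sf P}\cdot{\sf Q}-p\,{\sf P}\cdot{\sf D}{\sf Q}$. For $2\leqslant i\leqslant n$ define the initial invariants inductively by $\Lambda_{1,i}^{3}:=[f_i',f_1']$ (with weights $1$, $1$) and, for $3\leqslant\lambda\leqslant\kappa$, $\Lambda_{1,i;1^{\lambda-2}}^{2\lambda-1}:=\big[\Lambda_{1,i;1^{\lambda-3}}^{2\lambda-3},f_1'\big]$ (with weights $2\lambda-3$, $1$). For $1\leqslant n_1\leqslant n$ and arbitrary $\lambda_2,\dots,\lambda_{n_1}\in\{2,\dots,\kappa\}$ let $$\Pi_{2,\dots,n_1}^{\lambda_2,\dots,\lambda_{n_1}}:=\det\Big(\Lambda_{1,i;1^{\lambda_j-2}}^{2\lambda_j-1}\Big)_{2\leqslant j\leqslant n_1,\ 2\leqslant i\leqslant n_1},$$ where $j$ indexes the rows and $i$ the columns (the empty determinant, for $n_1=1$, is $1$). Theorem. For every bi-invariant ${\sf BP}$ of weight $m$ there exist polynomials ${\sf BP}_a$ with complex coefficients, indexed by the integers $a$ with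 $-\frac{\kappa-1}{\kappa}m\leqslant a\leqslant m$, in variables indexed by the data $(n_1;\lambda_2,\dots,\lambda_{n_1})$ above, such that $${\sf BP}\big(j^\kappa f\big)=\sum_{-\frac{\kappa-1}{\kappa}m\leqslant a\leqslant m}(f_1')^a\,{\sf BP}_a\Big(\Pi_{2,\dots,n_1}^{\lambda_2,\dots,\lambda_{n_1}}\ :\ 1\leqslant n_1\leqslant n,\ 2\leqslant\lambda_2,\dots,\lambda_{n_1}\leqslant\kappa\Big)$$ in the field of rational functions of the jet variables. -/

import Mathlib

namespace JetInvariants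

/-- Polynomials in the jet variables of `n` functions: the variable `X (i, l)` stands for the
derivative `f_{i+1}^{(l)}` (the index `i : Fin n` counts from `0`, so `f_1` is index `0`). -/
abbrev JetPoly (n : ℕ) : Type := MvPolynomial (Fin n × ℕ) ℂ

/-- `P` is a polynomial in the `κ`-jet `(f', f'', …, f^{(κ)})`: only the variables `f_i^{(l)}`
with `1 ≤ l ≤ κ` occur. -/
def IsJetPolyOfOrder (n κ : ℕ) (P : JetPoly n) : Prop :=
  P ∈ MvPolynomial.supported ℂ {v : Fin n × ℕ | 1 ≤ v.2 ∧ v.2 ≤ κ}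

/-- The jet at the origin of `f = (f_1, …, f_n)`: the collection of all derivatives
`f_i^{(l)}(0)`. -/
noncomputable def jet {n : ℕ} (f : Fin n → ℂ → ℂ) : Fin n × ℕ → ℂ :=
  fun v => iteratedDeriv v.2 (f v.1) 0

/-- Invariance by reparametrization with weight `m`:
`P (j(f ∘ φ)) = φ'(0) ^ m * P (j f)` at the origin, for all germs of holomorphic curves `f`
and all germs of biholomorphisms `φ` of `(ℂ, 0)`. -/
def IsReparamInvariant {n : ℕ} (m : ℕ) (P : JetPoly n) : Prop :=
  ∀ (f : Fin n → ℂ → ℂ) (φ : ℂ → ℂ), (∀ i, AnalyticAt ℂ (f i) 0) →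
    AnalyticAt ℂ φ 0 → φ 0 = 0 → deriv φ 0 ≠ 0 →
    MvPolynomial.eval (jet fun i => f i ∘ φ) P = deriv φ 0 ^ m * MvPolynomial.eval (jet f) P

/-- Linear substitution by a matrix `w`, the same one at each jet level:
`w · f_i^{(l)} = ∑ j, w i j * f_j^{(l)}`. -/
noncomputable def linAct {n : ℕ} (w : Matrix (Fin n) (Fin n) ℂ) : JetPoly n →ₐ[ℂ] JetPoly n :=
  MvPolynomial.aeval fun v => ∑ j, MvPolynomial.C (w v.1 j) * MvPolynomial.X (j, v.2)

/-- Lower triangular matrices with all diagonal entries equal to `1`. -/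
def IsLowerUnipotent {n : ℕ} (u : Matrix (Fin n) (Fin n) ℂ) : Prop :=
  (∀ i, u i i = 1) ∧ ∀ i j, i < j → u i j = 0

/-- Bi-invariants of weight `m` in dimension `n` and jet order `κ`. -/
structure IsBiInvariant (n κ m : ℕ) (P : JetPoly n) : Prop where
  order : IsJetPolyOfOrder n κ P
  reparam : IsReparamInvariant m P
  unipotent : ∀ u : Matrix (Fin n) (Fin n) ℂ, IsLowerUnipotent u → linAct u P = P

/-- The total differentiation operator `D = ∑ ∂/∂f_k^{(l)} · f_k^{(l+1)}`. -/
noncomputable def totalD (n : ℕ) : Derivation ℂ (JetPoly n) (JetPoly n) :=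
  MvPolynomial.mkDerivation ℂ fun v => MvPolynomial.X (v.1, v.2 + 1)

/-- The bracket `[P, Q] = q · DP · Q - p · P · DQ` of `P` of weight `p` and `Q` of weight `q`. -/
noncomputable def bracket {n : ℕ} (p q : ℕ) (P Q : JetPoly n) : JetPoly n :=
  (q : JetPoly n) * totalD n P * Q - (p : JetPoly n) * P * totalD n Q

/-- The initial invariants: `initInv i k` is `Λ_{1,i;1^{l-2}}^{2l-1}` with `l = k + 2`, which has
weight `2 l - 1 = 2 k + 3`. They are obtained from `[f_i', f_1']` by bracketing `k` times
with `f_1'`. -/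
noncomputable def initInv {n : ℕ} [NeZero n] (i : Fin n) : ℕ → JetPoly n
  | 0 => bracket 1 1 (MvPolynomial.X (i, 1)) (MvPolynomial.X (0, 1))
  | k + 1 => bracket (2 * k + 3) 1 (initInv i k) (MvPolynomial.X (0, 1))

/-- Index of a minor: its size `r = n_1 - 1`, where `1 ≤ n_1 ≤ n`, and for each of its `r` rows an
arbitrary element `k` of `Fin (κ - 1)`, which stands for `l = k + 2` with `2 ≤ l ≤ κ`. -/
abbrev MinorIndex (n κ : ℕ) : Type := (r : Fin n) × (Fin r → Fin (κ - 1))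

/-- The minor with columns `i = 2, …, n_1` (that is `1, …, r` in `Fin n`) and with rows
`l_2, …, l_{n_1}`, of the array of initial invariants. It is `1` for `n_1 = 1`. -/
noncomputable def minor (n κ : ℕ) [NeZero n] (μ : MinorIndex n κ) : JetPoly n :=
  Matrix.det (Matrix.of fun s t : Fin μ.1 =>
    initInv (⟨t + 1, by omega⟩ : Fin n) (μ.2 s : ℕ))

end JetInvariants

/-!
The proof compares the value of a bi-invariant `P` on a curve `f` with its value on a normalized
curve, and then describes the restriction of `P` to normalized curves by classical invariant theory.

*Normalization.* If `f₁'(0) ≠ 0`, reparametrization by the local inverse of `f₁` gives a curve with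
first component `t`, up to a constant, and with `l`-th derivatives `Λ_i / (f₁')^(2l-1)` for `l ≥ 2`:
the bracket with `f₁'` is exactly differentiation of such quotients along `f ∘ f₁⁻¹`
(`hasDerivAt_eval_div_pow`, `IsReparamInvariant.eval_eq_mul_eval_normalizedJet`). A unipotent matrix
then removes the first derivatives of `f₂, …, f_n` (`eval_normalizedJet`). Hence
`P = (f₁')^m Q(Λ_{i,l} / (f₁')^(2l-1))`, where `Q` is the restriction of `P` to normalized curves, a
polynomial in the entries of an `(n-1) × (κ-1)` matrix. It is invariant under adding a multiple of
one row to a later one (`rowAdd_aeval_sliceCoord`).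

*Invariants of the unipotent group.* Such a `Q` is a polynomial in the minors on the first `r` rows
(`mem_adjoin_initMinor`). For a lexicographic order in which the leading monomial of a minor is its
diagonal, it suffices that the leading exponent of every invariant be that of a product of such
minors. An exponent matrix `a` has this form when its consecutive rows satisfy the ballot
inequalities `a_{i+1,0} + ⋯ + a_{i+1,k} ≤ a_{i,0} + ⋯ + a_{i,k-1}`: one peels off the first nonzero
entries of the rows, that is, the columns of a semistandard tableau (`IsBallot.exists_eq_add`). The
ballot inequalities for the leading exponent (`sum_lex_degree_le`) involve two rows only. The
multihomogeneous components of the invariant next to the leading one form a chain under the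
operator `e = ∑ x_{i,l} ∂/∂x_{i+1,l}` restricted to the columns `l < k`. The last member of this
chain is a nonzero polynomial killed by a known power of `e`, and the representation theory of
`sl₂` bounds its bidegree (`eq_zero_of_pow_raising_eq_zero`).

*The exponents.* By homogeneity, `∑ l ≤ m` over the factors of each monomial of `Q`, and
`κ (2l-1) ≤ (2κ-1) l` for `l ≤ κ`. So the total exponent `N` of `f₁'` in the denominators satisfies
`κ N ≤ (2κ-1) m`, and `a = m - N` lies in the stated range
(`eq_sum_weightedHomogeneousComponent`).
-/

namespace JetInvariants

open MvPolynomial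

/-! ### Lowering and raising operators on a bigraded space -/

section Sl2

variable {W : Type*} [AddCommGroup W] [Module ℂ W] {e f : Module.End ℂ W}
  {S : ℤ → ℤ → Submodule ℂ W}

lemma pow_raising_lowering
    (he : ∀ A B u, u ∈ S A B → e u ∈ S (A + 1) (B - 1))
    (hcomm : ∀ A B u, u ∈ S A B → e (f u) - f (e u) = ((A - B : ℤ) : ℂ) • u) (N : ℕ) :
    ∀ (A B : ℤ) (u : W), u ∈ S A B → (e ^ (N + 1)) (f u) =
      f ((e ^ (N + 1)) u) + (((N + 1) * (A - B + N) : ℤ) : ℂ) • (e ^ N) u := by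
  induction N with
  | zero =>
    intro A B u hu
    have := hcomm A B u hu
    simpa [sub_eq_iff_eq_add'] using this
  | succ N ih =>
    intro A B u hu
    have h1 : e (f u) = f (e u) + ((A - B : ℤ) : ℂ) • u := by
      rw [← hcomm A B u hu]; abel
    have h2 := ih _ _ _ (he A B u hu)
    have h3 : ∀ k (x : W), (e ^ (k + 1)) x = (e ^ k) (e x) := fun k x => by
      rw [pow_succ]; rfl
    rw [h3 (N + 1) (f u), h1, map_add, h2, map_smul, h3 (N + 1) u, h3 N u, add_assoc, ← add_smul]
    congr 2
    push_cast
    ring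

/-- The representation theory of `sl₂` in the form needed here: in bidegree `(A, B)` the
`N`-th power of the raising operator is injective as soon as `N ≤ B - A`. -/
theorem eq_zero_of_pow_raising_eq_zero
    (he : ∀ A B u, u ∈ S A B → e u ∈ S (A + 1) (B - 1))
    (hf : ∀ A B u, u ∈ S A B → f u ∈ S (A - 1) (B + 1))
    (hneg : ∀ A B u, u ∈ S A B → A < 0 → u = 0)
    (hcomm : ∀ A B u, u ∈ S A B → e (f u) - f (e u) = ((A - B : ℤ) : ℂ) • u)
    (N : ℕ) (A B : ℤ) (u : W) (hu : u ∈ S A B) (hN : (N : ℤ) ≤ B - A) (h0 : (e ^ N) u = 0) :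
    u = 0 := by
  -- induction on the degree `A`, which the lowering operator decreases
  obtain ⟨a, ha⟩ : ∃ a : ℕ, A + 1 ≤ a := ⟨(A + 1).toNat, Int.self_le_toNat _⟩
  induction a generalizing N A B u with
  | zero => exact hneg A B u hu (by push_cast at ha; lia)
  | succ a iha =>
    induction N with
    | zero => simpa using h0
    | succ N ihN =>
      refine ihN (by push_cast at hN; lia) ?_
      have h1 : (e ^ (N + 2)) u = 0 := by
        rw [pow_succ', Module.End.mul_apply, h0, map_zero]
      have h2 := pow_raising_lowering he hcomm (N + 1) A B u hu
      have h3 : f u = 0 := by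
        refine iha (N + 2) (A - 1) (B + 1) (f u) (hf A B u hu) (by push_cast at hN ⊢; lia) ?_
          (by push_cast at ha ⊢; lia)
        rw [h2, h1, h0]
        simp
      have h4 := pow_raising_lowering he hcomm N A B u hu
      rw [h3, h0, map_zero, map_zero, zero_add] at h4
      rcases smul_eq_zero.1 h4.symm with h | h
      · rw [Int.cast_eq_zero] at h
        rcases mul_eq_zero.1 h with h | h <;> push_cast at hN <;> lia
      · exact h

end Sl2

/-! ### Derivations and weights -/

section Weights

variable {σ M : Type*} [AddCommGroup M] {w : σ → M}

lemma isWeightedHomogeneous_derivation_monomial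
    (D : Derivation ℂ (MvPolynomial σ ℂ) (MvPolynomial σ ℂ)) {δ : M}
    (hD : ∀ v, IsWeightedHomogeneous w (D (X v)) (w v + δ)) (d : σ →₀ ℕ) :
    IsWeightedHomogeneous w (D (monomial d 1)) (Finsupp.weight w d + δ) := by
  induction d using Finsupp.induction_linear with
  | zero =>
    rw [show (monomial (0 : σ →₀ ℕ) (1 : ℂ)) = 1 from rfl, D.map_one_eq_zero]
    exact isWeightedHomogeneous_zero ..
  | add d e hd he =>
    have h : (monomial (d + e) (1 : ℂ)) = monomial d 1 * monomial e 1 := by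
      rw [monomial_mul, one_mul]
    rw [h, D.leibniz, map_add, smul_eq_mul, smul_eq_mul]
    refine IsWeightedHomogeneous.add ?_ ?_
    · rw [add_assoc]
      exact (isWeightedHomogeneous_monomial w d 1 rfl).mul he
    · rw [add_comm (Finsupp.weight w d), add_assoc]
      exact (isWeightedHomogeneous_monomial w e 1 rfl).mul hd
  | single v k =>
    have h : monomial (Finsupp.single v k) (1 : ℂ) = X v ^ k := by
      rw [X_pow_eq_monomial]
    rw [h, D.leibniz_pow, smul_eq_mul, nsmul_eq_mul, ← map_natCast (C (σ := σ) (R := ℂ))]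
    cases k with
    | zero => simpa using isWeightedHomogeneous_zero ..
    | succ k =>
      refine IsWeightedHomogeneous.C_mul ?_ _
      have := ((isWeightedHomogeneous_X ℂ w v).pow k).mul (hD v)
      convert! this using 1
      rw [Finsupp.weight_single, add_smul, one_smul, add_assoc]

lemma weightedHomogeneousComponent_derivation
    (D : Derivation ℂ (MvPolynomial σ ℂ) (MvPolynomial σ ℂ)) {δ : M}
    (hD : ∀ v, IsWeightedHomogeneous w (D (X v)) (w v + δ)) (F : MvPolynomial σ ℂ) (μ : M) :
    weightedHomogeneousComponent w μ (D F) = D (weightedHomogeneousComponent w (μ - δ) F) := by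
  rw [F.as_sum]
  simp only [map_sum]
  refine Finset.sum_congr rfl fun d _ => ?_
  have h : monomial d (coeff d F) = coeff d F • monomial d (1 : ℂ) := by
    rw [smul_monomial, smul_eq_mul, mul_one]
  rw [h, D.map_smul, map_smul, map_smul, D.map_smul]
  congr 1
  have h1 := isWeightedHomogeneous_derivation_monomial D hD d
  have h2 := isWeightedHomogeneous_monomial w d (1 : ℂ) rfl
  by_cases hμ : Finsupp.weight w d + δ = μ
  · subst hμ
    rw [h1.weightedHomogeneousComponent_same, add_sub_cancel_right,
      h2.weightedHomogeneousComponent_same]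
  · rw [h1.weightedHomogeneousComponent_ne _ (Ne.symm hμ), h2.weightedHomogeneousComponent_ne,
      map_zero]
    intro h
    exact hμ (by rw [← h, sub_add_cancel])

/-- Euler's identity for a derivation that acts on each variable by a scalar. -/
lemma derivation_apply_of_isWeightedHomogeneous
    (D : Derivation ℂ (MvPolynomial σ ℂ) (MvPolynomial σ ℂ)) (χ : M →+ ℂ)
    (hD : ∀ v, D (X v) = χ (w v) • X v) {F : MvPolynomial σ ℂ} {μ : M}
    (hF : IsWeightedHomogeneous w F μ) : D F = χ μ • F := by
  have key : ∀ d : σ →₀ ℕ, D (monomial d 1) = χ (Finsupp.weight w d) • monomial d 1 := by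
    intro d
    induction d using Finsupp.induction_linear with
    | zero =>
      rw [show (monomial (0 : σ →₀ ℕ) (1 : ℂ)) = 1 from rfl, D.map_one_eq_zero]
      simp
    | add d e hd he =>
      have h : (monomial (d + e) (1 : ℂ)) = monomial d 1 * monomial e 1 := by
        rw [monomial_mul, one_mul]
      rw [h, D.leibniz, hd, he, map_add, map_add, add_smul, smul_eq_mul, smul_eq_mul,
        mul_smul_comm, mul_smul_comm, mul_comm (monomial e 1), add_comm]
    | single v k =>
      have h : monomial (Finsupp.single v k) (1 : ℂ) = X v ^ k := by
        rw [X_pow_eq_monomial]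
      rw [h, D.leibniz_pow, hD, Finsupp.weight_single, map_nsmul]
      cases k with
      | zero => simp
      | succ k =>
        rw [Nat.add_sub_cancel, smul_eq_mul, mul_smul_comm, ← pow_succ, smul_assoc]
  conv_lhs => rw [F.as_sum]
  conv_rhs => rw [F.as_sum]
  rw [map_sum, Finset.smul_sum]
  refine Finset.sum_congr rfl fun d hd => ?_
  have h : monomial d (coeff d F) = coeff d F • monomial d (1 : ℂ) := by
    rw [smul_monomial, smul_eq_mul, mul_one]
  rw [h, D.map_smul, key, hF (mem_support_iff.1 hd), smul_comm]

end Weights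

section RowOperations

/-! ### Variables of a matrix and row operations -/

/-- Positions `(i, k)` (row `i`, column `k`) in a `p × q` matrix. The linear order lists the
columns from the last to the first and, within a column, the rows from the last to the first, so
that lexicographic comparison of monomials looks at the last entry of the last column first. For
the resulting monomial order the leading monomial of a minor is its diagonal. -/
abbrev MatVar (p q : ℕ) : Type := (Fin q)ᵒᵈ ×ₗ (Fin p)ᵒᵈ

variable {p q : ℕ}

/-- The position in row `i` and column `k`. -/
def matVar (i : Fin p) (k : Fin q) : MatVar p q := toLex (OrderDual.toDual k, OrderDual.toDual i)

/-- The row of a position. -/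
def matRow (v : MatVar p q) : Fin p := OrderDual.ofDual (ofLex v).2

/-- The column of a position. -/
def matCol (v : MatVar p q) : Fin q := OrderDual.ofDual (ofLex v).1

@[simp] lemma matRow_matVar (i : Fin p) (k : Fin q) : matRow (matVar i k) = i := rfl

@[simp] lemma matCol_matVar (i : Fin p) (k : Fin q) : matCol (matVar i k) = k := rfl

@[simp] lemma matVar_matRow_matCol (v : MatVar p q) : matVar (matRow v) (matCol v) = v := rfl

lemma matVar_inj {i j : Fin p} {k l : Fin q} : matVar i k = matVar j l ↔ i = j ∧ k = l := by
  constructor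
  · intro h
    exact ⟨congrArg matRow h, congrArg matCol h⟩
  · rintro ⟨rfl, rfl⟩
    rfl

lemma matVar_lt {i j : Fin p} {k l : Fin q} :
    matVar i k < matVar j l ↔ l < k ∨ k = l ∧ j < i := by
  rw [Prod.Lex.lt_iff]
  rfl

lemma sum_matVar {N : Type*} [AddCommMonoid N] (g : MatVar p q → N) :
    ∑ v, g v = ∑ i, ∑ k, g (matVar i k) := by
  rw [← Fintype.sum_prod_type' (f := fun i k => g (matVar i k))]
  exact Fintype.sum_equiv ⟨fun v => (matRow v, matCol v), fun x => matVar x.1 x.2,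
    fun _ => rfl, fun _ => rfl⟩ _ _ fun _ => rfl

/-- The derivation `∑ x_{i,l} ∂/∂x_{j,l}`, the sum being over the columns `l ∈ s`. -/
noncomputable def rowDer (s : Finset (Fin q)) (i j : Fin p) :
    Derivation ℂ (MvPolynomial (MatVar p q) ℂ) (MvPolynomial (MatVar p q) ℂ) :=
  ∑ l ∈ s, (X (matVar i l) : MvPolynomial (MatVar p q) ℂ) • pderiv (matVar j l)

lemma rowDer_apply (s : Finset (Fin q)) (i j : Fin p) (F : MvPolynomial (MatVar p q) ℂ) :
    rowDer s i j F = ∑ l ∈ s, X (matVar i l) * pderiv (matVar j l) F := by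
  unfold rowDer
  rw [← Derivation.coeFnAddMonoidHom_apply, map_sum, Finset.sum_apply]
  rfl

lemma rowDer_X (s : Finset (Fin q)) (i j r : Fin p) (l : Fin q) :
    rowDer s i j (X (matVar r l)) = if r = j ∧ l ∈ s then X (matVar i l) else 0 := by
  classical
  rw [rowDer_apply]
  simp only [pderiv_X, Pi.single_apply, matVar_inj]
  by_cases hr : r = j
  · simp [hr]
  · simp [hr]

lemma rowDer_sum (s : Finset (Fin q)) (i j : Fin p) (F : MvPolynomial (MatVar p q) ℂ) :
    rowDer s i j F = ∑ l ∈ s, rowDer {l} i j F := by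
  rw [rowDer_apply]
  refine Finset.sum_congr rfl fun l _ => ?_
  rw [rowDer_apply, Finset.sum_singleton]

lemma isWeightedHomogeneous_rowDer_X {M : Type*} [AddCommGroup M] {w : MatVar p q → M}
    {s : Finset (Fin q)} {i j : Fin p} {δ : M}
    (hδ : ∀ l ∈ s, w (matVar i l) = w (matVar j l) + δ) (v : MatVar p q) :
    IsWeightedHomogeneous w (rowDer s i j (X v)) (w v + δ) := by
  rw [← matVar_matRow_matCol v, rowDer_X]
  split_ifs with h
  · rw [h.1, ← hδ _ h.2]
    exact isWeightedHomogeneous_X ..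
  · exact isWeightedHomogeneous_zero ..

lemma isWeightedHomogeneous_rowDer {M : Type*} [AddCommGroup M] {w : MatVar p q → M}
    {s : Finset (Fin q)} {i j : Fin p} {δ : M}
    (hδ : ∀ l ∈ s, w (matVar i l) = w (matVar j l) + δ) {F : MvPolynomial (MatVar p q) ℂ} {μ : M}
    (hF : IsWeightedHomogeneous w F μ) : IsWeightedHomogeneous w (rowDer s i j F) (μ + δ) := by
  have h := weightedHomogeneousComponent_derivation (rowDer s i j)
    (isWeightedHomogeneous_rowDer_X hδ) F (μ + δ)
  rw [add_sub_cancel_right, hF.weightedHomogeneousComponent_same] at h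
  rw [← h]
  exact weightedHomogeneousComponent_isWeightedHomogeneous ..

/-! ### The ballot inequalities for the leading exponent -/

section Ballot

/-- The bidegree in the first `k` entries of the rows `i` and `j`. -/
def pairWeight (i j : Fin p) (k : Fin q) (v : MatVar p q) : ℤ × ℤ :=
  (if matRow v = i ∧ matCol v < k then 1 else 0, if matRow v = j ∧ matCol v < k then 1 else 0)

/-- The multidegree that records the exponent of each variable, except for the first `k` entries
of the rows `i` and `j`, of which only the two total degrees are recorded. -/
def ballotWeight (i j : Fin p) (k : Fin q) (v : MatVar p q) : (MatVar p q → ℤ) × ℤ × ℤ :=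
  (fun u => if u = v ∧ ¬((matRow v = i ∨ matRow v = j) ∧ matCol v < k) then 1 else 0,
    pairWeight i j k v)

variable {i j : Fin p} {k : Fin q}

lemma weight_ballotWeight_snd (d : MatVar p q →₀ ℕ) :
    (Finsupp.weight (ballotWeight i j k) d).2 = Finsupp.weight (pairWeight i j k) d := by
  rw [Finsupp.weight_eq_sum, Finsupp.weight_eq_sum, Prod.snd_sum]
  rfl

lemma weight_ballotWeight_fst (d : MatVar p q →₀ ℕ) (u : MatVar p q) (hu : k ≤ matCol u) :
    (Finsupp.weight (ballotWeight i j k) d).1 u = d u := by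
  rw [Finsupp.weight_eq_sum, Prod.fst_sum, Finset.sum_apply, Finset.sum_eq_single u]
  · simp [ballotWeight, hu]
  · intro v _ hv
    simp [ballotWeight, hv.symm]
  · simp

lemma weight_pairWeight (d : MatVar p q →₀ ℕ) :
    Finsupp.weight (pairWeight i j k) d =
      (((∑ l ∈ Finset.Iio k, d (matVar i l) : ℕ) : ℤ),
        ((∑ l ∈ Finset.Iio k, d (matVar j l) : ℕ) : ℤ)) := by
  have h : ∀ r : Fin p, (∑ a, ∑ l, if a = r ∧ l < k then (d (matVar a l) : ℤ) else 0) =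
      ((∑ l ∈ Finset.Iio k, d (matVar r l) : ℕ) : ℤ) := by
    intro r
    rw [Finset.sum_eq_single r]
    · simp only [true_and]
      rw [← Finset.sum_filter, Nat.cast_sum]
      refine Finset.sum_congr ?_ fun _ _ => rfl
      ext l
      simp
    · intro a _ ha
      simp [ha]
    · simp
  rw [Finsupp.weight_eq_sum, sum_matVar, ← h, ← h]
  ext
  · simp only [Prod.fst_sum, Prod.smul_fst, pairWeight]
    refine Finset.sum_congr rfl fun a _ => Finset.sum_congr rfl fun l _ => ?_
    rw [matRow_matVar, matCol_matVar]
    split_ifs <;> simp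
  · simp only [Prod.snd_sum, Prod.smul_snd, pairWeight]
    refine Finset.sum_congr rfl fun a _ => Finset.sum_congr rfl fun l _ => ?_
    rw [matRow_matVar, matCol_matVar]
    split_ifs <;> simp

lemma rowDer_commutator (hij : i ≠ j) {A B : ℤ} {u : MvPolynomial (MatVar p q) ℂ}
    (hu : IsWeightedHomogeneous (pairWeight i j k) u (A, B)) :
    rowDer (Finset.Iio k) i j (rowDer (Finset.Iio k) j i u) -
      rowDer (Finset.Iio k) j i (rowDer (Finset.Iio k) i j u) = ((A - B : ℤ) : ℂ) • u := by
  let χ : ℤ × ℤ →+ ℂ := (Int.castAddHom ℂ).comp (AddMonoidHom.fst ℤ ℤ - AddMonoidHom.snd ℤ ℤ)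
  have key : ∀ v, ⁅rowDer (Finset.Iio k) i j, rowDer (Finset.Iio k) j i⁆ (X v) =
      χ (pairWeight i j k v) • X v := ?_
  · rw [← Derivation.commutator_apply, derivation_apply_of_isWeightedHomogeneous _ χ key hu]
    simp [χ]
  intro v
  rw [← matVar_matRow_matCol v, Derivation.commutator_apply, rowDer_X, rowDer_X]
  by_cases hl : matCol v < k
  · by_cases h1 : matRow v = i
    · simp [χ, pairWeight, h1, hl, hij, rowDer_X]
    · by_cases h2 : matRow v = j
      · simp [χ, pairWeight, h2, hl, hij.symm, rowDer_X]
      · simp [χ, pairWeight, h1, h2]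
  · simp [χ, pairWeight, hl]

lemma rowDer_commute (hij : i ≠ j) (s t : Finset (Fin q)) (u : MvPolynomial (MatVar p q) ℂ) :
    rowDer s i j (rowDer t i j u) = rowDer t i j (rowDer s i j u) := by
  have h : ⁅rowDer s i j, rowDer t i j⁆ = 0 := by
    refine derivation_ext fun v => ?_
    rw [← matVar_matRow_matCol v, Derivation.commutator_apply, rowDer_X, rowDer_X]
    split_ifs <;> simp [rowDer_X, hij]
  rw [← sub_eq_zero, ← Derivation.commutator_apply, h, Derivation.zero_apply]

lemma lex_degree_apply_le {σ : Type*} [LinearOrder σ] [WellFoundedGT σ] {F : MvPolynomial σ ℂ}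
    {d : σ →₀ ℕ} (hd : coeff d F ≠ 0) (v : σ)
    (h : ∀ u < v, d u = MonomialOrder.lex.degree F u) : d v ≤ MonomialOrder.lex.degree F v := by
  have h1 := MonomialOrder.lex.le_degree (mem_support_iff.2 hd)
  rw [MonomialOrder.lex_le_iff] at h1
  by_contra! h2
  refine not_lt_of_ge h1 (Finsupp.Lex.lt_iff.2 ⟨v, fun u hu => (h u hu).symm, h2⟩)

/-- Components whose multidegree exceeds that of the leading exponent vanish. -/
lemma weightedHomogeneousComponent_eq_zero_of_lex_lt {F : MvPolynomial (MatVar p q) ℂ}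
    (ν : (MatVar p q → ℤ) × ℤ × ℤ) (v : MatVar p q) (hv : k ≤ matCol v)
    (h1 : (MonomialOrder.lex.degree F v : ℤ) < ν.1 v)
    (h2 : ∀ u < v, ν.1 u = MonomialOrder.lex.degree F u) :
    weightedHomogeneousComponent (ballotWeight i j k) ν F = 0 := by
  refine weightedHomogeneousComponent_eq_zero' _ _ fun d hd h => ?_
  have h3 : ∀ u, k ≤ matCol u → ν.1 u = d u := fun u hu => by
    rw [← h, weight_ballotWeight_fst d u hu]
  have h4 := lex_degree_apply_le (mem_support_iff.1 hd) v fun u hu => by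
    have : k ≤ matCol u := by
      rw [← matVar_matRow_matCol u, ← matVar_matRow_matCol v, matVar_lt] at hu
      rcases hu with hu | hu
      · exact hv.trans hu.le
      · exact hu.1 ▸ hv
    have h5 := h2 u hu
    rw [h3 u this] at h5
    exact_mod_cast h5
  rw [h3 v hv] at h1
  lia

/-- The leading exponent `a` of a polynomial killed by `∑ x_{i,l} ∂/∂x_{j,l}`, where `i < j`,
satisfies the ballot inequalities
`a_{j,0} + ⋯ + a_{j,k} ≤ a_{i,0} + ⋯ + a_{i,k-1}`. -/
theorem sum_lex_degree_le (hij : i < j) {F : MvPolynomial (MatVar p q) ℂ} (hF : F ≠ 0)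
    (hE : rowDer Finset.univ i j F = 0) (k : Fin q) :
    ∑ l ∈ Finset.Iic k, MonomialOrder.lex.degree F (matVar j l) ≤
      ∑ l ∈ Finset.Iio k, MonomialOrder.lex.degree F (matVar i l) := by
  classical
  set a := MonomialOrder.lex.degree F with ha
  set w := ballotWeight i j k with hw
  set μ := Finsupp.weight w a with hμ
  have hμ1 : ∀ u, k ≤ matCol u → μ.1 u = a u := fun u hu => weight_ballotWeight_fst a u hu
  have hμ2 : μ.2 = (((∑ l ∈ Finset.Iio k, a (matVar i l) : ℕ) : ℤ),
      ((∑ l ∈ Finset.Iio k, a (matVar j l) : ℕ) : ℤ)) := by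
    rw [hμ, weight_ballotWeight_snd, weight_pairWeight]
  -- the shift of multidegree caused by the part of the derivation in column `l`
  let δ : Fin q → (MatVar p q → ℤ) × ℤ × ℤ := fun l => w (matVar i l) - w (matVar j l)
  have hδlow : ∀ l < k, δ l = (0, 1, -1) := by
    intro l hl
    ext u <;> simp [δ, hw, ballotWeight, pairWeight, hl, hl.not_ge, hij.ne, hij.ne']
  have hδhigh : ∀ l, k ≤ l → δ l = (fun u => (if u = matVar i l then 1 else 0) -
      if u = matVar j l then 1 else 0, 0, 0) := by
    intro l hl
    ext u <;> simp [δ, hw, ballotWeight, pairWeight, hl, hl.not_gt]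
  let ε : (MatVar p q → ℤ) × ℤ × ℤ := (0, 1, -1)
  -- The component `h 0` contains the leading monomial; from `h n` to `h (n + 1)` one factor
  -- `x_{j,k}` becomes `x_{i,k}`, while the row degrees stay the same.
  let h : ℤ → MvPolynomial (MatVar p q) ℂ := fun n =>
    weightedHomogeneousComponent w (μ + n • (δ k - ε)) F
  have hh : ∀ n, IsWeightedHomogeneous w (h n) (μ + n • (δ k - ε)) := fun n =>
    weightedHomogeneousComponent_isWeightedHomogeneous ..
  -- the component of multidegree `ν` of the hypothesis `hE`
  have hcomp : ∀ ν, ∑ l, rowDer {l} i j (weightedHomogeneousComponent w (ν - δ l) F) = 0 := by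
    intro ν
    rw [← map_zero (weightedHomogeneousComponent w ν), ← hE, rowDer_sum, map_sum]
    refine Finset.sum_congr rfl fun l _ => ?_
    refine (weightedHomogeneousComponent_derivation (rowDer {l} i j)
      (isWeightedHomogeneous_rowDer_X ?_) F ν).symm
    intro l' hl'
    rw [Finset.mem_singleton.1 hl']
    simp [δ]
  -- the columns after `k` do not contribute, because `F` has no monomials above the leading one
  have hrel : ∀ n, rowDer (Finset.Iio k) i j (h n) = - rowDer {k} i j (h (n - 1)) := by
    intro n
    have h1 := hcomp (μ + n • (δ k - ε) + ε)
    rw [← Finset.sum_subset (Finset.subset_univ (insert k (Finset.Iio k))),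
      Finset.sum_insert (by simp)] at h1
    · rw [eq_neg_iff_add_eq_zero, add_comm, rowDer_sum (Finset.Iio k), ← h1]
      have e1 : μ + n • (δ k - ε) + ε - δ k = μ + (n - 1) • (δ k - ε) := by
        rw [sub_smul, one_smul]
        abel
      rw [e1]
      refine congrArg₂ _ rfl (Finset.sum_congr rfl fun l hl => ?_)
      rw [hδlow l (Finset.mem_Iio.1 hl), add_sub_cancel_right]
    · intro l _ hl
      have hl : k < l := by
        simp only [Finset.mem_insert, Finset.mem_Iio, not_or] at hl
        lia
      rw [weightedHomogeneousComponent_eq_zero_of_lex_lt _ (matVar j l), map_zero]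
      · exact hl.le
      · have := hμ1 (matVar j l) hl.le
        simp [hδhigh, hl.le, ε, matVar_inj, hij.ne', hl.ne', this, ← ha]
      · intro u hu
        have hu' : matVar j l < matVar i l := matVar_lt.2 (Or.inr ⟨rfl, hij⟩)
        have hk : matVar j l < matVar j k := matVar_lt.2 (Or.inl hl)
        have hk' : matVar j l < matVar i k := matVar_lt.2 (Or.inl hl)
        have huk : k ≤ matCol u := by
          rw [← matVar_matRow_matCol u, matVar_lt] at hu
          rcases hu with hu | hu
          · exact hl.le.trans hu.le
          · exact hu.1 ▸ hl.le
        have := hμ1 u huk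
        simp [hδhigh, hl.le, ε, hu.ne, (hu.trans hu').ne, (hu.trans hk).ne, (hu.trans hk').ne,
          this, ← ha]
  have hneg : h (-1) = 0 := by
    refine weightedHomogeneousComponent_eq_zero_of_lex_lt _ (matVar j k) le_rfl ?_ ?_
    · have := hμ1 (matVar j k) le_rfl
      simp [hδhigh, ε, matVar_inj, hij.ne', this, ← ha]
    · intro u hu
      have hu' : matVar j k < matVar i k := matVar_lt.2 (Or.inr ⟨rfl, hij⟩)
      have huk : k ≤ matCol u := by
        rw [← matVar_matRow_matCol u, matVar_lt] at hu
        rcases hu with hu | hu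
        · exact hu.le
        · exact hu.1 ▸ le_rfl
      have := hμ1 u huk
      simp [hδhigh, ε, hu.ne, (hu.trans hu').ne, this, ← ha]
  -- `h n` is killed by the `(n + 1)`-st power of the derivation on the first `k` columns
  let e : Module.End ℂ (MvPolynomial (MatVar p q) ℂ) := (rowDer (Finset.Iio k) i j).toLinearMap
  let g : Module.End ℂ (MvPolynomial (MatVar p q) ℂ) := (rowDer {k} i j).toLinearMap
  have hcommute : Commute e g := by
    refine LinearMap.ext fun u => ?_
    exact rowDer_commute hij.ne _ _ u
  have hnil : ∀ n : ℕ, (e ^ (n + 1)) (h n) = 0 := by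
    intro n
    induction n with
    | zero =>
      have := hrel 0
      rw [zero_sub, hneg, map_zero, neg_zero] at this
      rw [zero_add, pow_one]
      exact this
    | succ n ih =>
      have h1 : e (h ((n + 1 : ℕ) : ℤ)) = - g (h n) := by
        have := hrel ((n + 1 : ℕ) : ℤ)
        rwa [Nat.cast_succ, add_sub_cancel_right] at this
      rw [pow_succ, Module.End.mul_apply, h1, map_neg, ← Module.End.mul_apply,
        (hcommute.pow_left (n + 1)).eq, Module.End.mul_apply, ih, map_zero, neg_zero]
  -- `∂/∂x_{j,k}` is injective on polynomials of a fixed positive degree in `x_{j,k}`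
  have hne : ∀ n : ℕ, n ≤ a (matVar j k) → h n ≠ 0 := by
    intro n
    induction n with
    | zero =>
      intro _ h0
      have h1 : coeff a (h 0) = coeff a F := by
        simp only [h, coeff_weightedHomogeneousComponent, zero_smul, add_zero]
        rw [if_pos hμ.symm]
      rw [show h 0 = 0 by simpa using h0, coeff_zero, eq_comm,
        MonomialOrder.lex.coeff_degree_eq_zero_iff] at h1
      exact hF h1
    | succ n ih =>
      intro hn h0
      have h1 := hrel ((n + 1 : ℕ) : ℤ)
      rw [h0, map_zero, Nat.cast_succ, add_sub_cancel_right, zero_eq_neg, rowDer_apply,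
        Finset.sum_singleton, mul_eq_zero] at h1
      have h2 := h1.resolve_left (X_ne_zero _)
      let χ : (MatVar p q → ℤ) × ℤ × ℤ →+ ℂ := (Int.castAddHom ℂ).comp
        ((Pi.evalAddMonoidHom (fun _ => ℤ) (matVar j k)).comp (AddMonoidHom.fst _ _))
      have h3 := derivation_apply_of_isWeightedHomogeneous
        ((X (matVar j k) : MvPolynomial (MatVar p q) ℂ) • pderiv (matVar j k)) χ ?_ (hh n)
      · rw [Derivation.smul_apply, h2, smul_zero, eq_comm, smul_eq_zero] at h3
        refine h3.elim ?_ (ih (by lia))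
        have h4 := hμ1 (matVar j k) le_rfl
        simp only [χ, AddMonoidHom.comp_apply, Pi.evalAddMonoidHom_apply, AddMonoidHom.coe_fst,
          Int.coe_castAddHom, Int.cast_eq_zero]
        simp [hδhigh, ε, matVar_inj, hij.ne', h4]
        lia
      · intro v
        by_cases hv : v = matVar j k
        · simp [χ, hv, hw, ballotWeight]
        · simp [χ, hw, ballotWeight, pderiv_X_of_ne hv, Ne.symm hv]
  by_contra! hlt
  set b := a (matVar j k) with hb
  rw [← Finset.Iio_insert k, Finset.sum_insert (by simp), ← hb] at hlt
  refine hne b le_rfl (eq_zero_of_pow_raising_eq_zero (e := e)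
    (f := (rowDer (Finset.Iio k) j i).toLinearMap)
    (S := fun A B => weightedHomogeneousSubmodule ℂ (pairWeight i j k) (A, B))
    ?_ ?_ ?_ ?_ (b + 1) (((∑ l ∈ Finset.Iio k, a (matVar i l) : ℕ) : ℤ) - b)
    (((∑ l ∈ Finset.Iio k, a (matVar j l) : ℕ) : ℤ) + b) _ ?_ ?_ (hnil b))
  · intro A B u hu
    have := isWeightedHomogeneous_rowDer (w := pairWeight i j k) (s := Finset.Iio k) (i := i)
      (j := j) (δ := (1, -1)) ?_ hu
    · exact this
    · intro l hl
      simp at hl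
      simp [pairWeight, hl, hij.ne, hij.ne']
  · intro A B u hu
    have := isWeightedHomogeneous_rowDer (w := pairWeight i j k) (s := Finset.Iio k) (i := j)
      (j := i) (δ := (-1, 1)) ?_ hu
    · exact this
    · intro l hl
      simp at hl
      simp [pairWeight, hl, hij.ne, hij.ne']
  · intro A B u hu hA
    by_contra hu0
    obtain ⟨d, hd⟩ := ne_zero_iff.1 hu0
    have := hu hd
    rw [weight_pairWeight, Prod.mk.injEq] at this
    lia
  · intro A B u hu
    exact rowDer_commutator hij.ne hu
  · intro d hd
    rw [← weight_ballotWeight_snd, hh b hd, Prod.snd_add, hμ2]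
    simp [hδhigh, ε, sub_eq_add_neg]
  · clear_value a b
    push_cast
    zify at hlt
    omega

end Ballot

/-! ### Initial minors and their leading monomials -/

/-- The minor of the generic `p × q` matrix on its first `r` rows and on the columns `c 0, …,
c (r - 1)`; the matrix is written transposed. -/
noncomputable def initMinor (r : ℕ) (hr : r ≤ p) (c : Fin r → Fin q) :
    MvPolynomial (MatVar p q) ℂ :=
  Matrix.det (Matrix.of fun s t : Fin r => X (matVar (Fin.castLE hr t) (c s)))

/-- The exponent of `∏ x_{t, c t}`. -/
noncomputable def pathExponent {r : ℕ} (hr : r ≤ p) (c : Fin r → Fin q) : MatVar p q →₀ ℕ :=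
  ∑ t, Finsupp.single (matVar (Fin.castLE hr t) (c t)) 1

lemma pathExponent_castLE {r : ℕ} (hr : r ≤ p) (c : Fin r → Fin q) (t : Fin r) (l : Fin q) :
    pathExponent hr c (matVar (Fin.castLE hr t) l) = if c t = l then 1 else 0 := by
  classical
  rw [pathExponent, Finsupp.finsetSum_apply, Finset.sum_eq_single t]
  · simp [Finsupp.single_apply, matVar_inj]
  · intro s _ hs
    simp [matVar_inj, hs]
  · simp

lemma pathExponent_of_le {r : ℕ} (hr : r ≤ p) (c : Fin r → Fin q) (a : Fin p) (ha : r ≤ a)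
    (l : Fin q) : pathExponent hr c (matVar a l) = 0 := by
  classical
  rw [pathExponent, Finsupp.finsetSum_apply]
  refine Finset.sum_eq_zero fun t _ => ?_
  rw [Finsupp.single_apply, if_neg]
  rw [matVar_inj]
  rintro ⟨h, -⟩
  rw [← h] at ha
  simp at ha
  lia

lemma initMinor_eq_sum {r : ℕ} (hr : r ≤ p) (c : Fin r → Fin q) :
    initMinor r hr c = ∑ σ : Equiv.Perm (Fin r),
      monomial (pathExponent hr (c ∘ σ)) ((Equiv.Perm.sign σ : ℤ) : ℂ) := by
  rw [initMinor, Matrix.det_apply']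
  refine Finset.sum_congr rfl fun σ _ => ?_
  have h : ∏ i, (Matrix.of fun s t : Fin r => (X (matVar (Fin.castLE hr t) (c s)) :
      MvPolynomial (MatVar p q) ℂ)) (σ i) i = monomial (pathExponent hr (c ∘ σ)) 1 := by
    rw [pathExponent, monomial_sum_one]
    rfl
  rw [h, ← mul_one (((Equiv.Perm.sign σ : ℤ) : ℂ)), ← C_mul_monomial]
  simp

/-- Among the monomials of a minor with increasing columns the diagonal one is the largest. -/
lemma pathExponent_comp_perm_lt {r : ℕ} (hr : r ≤ p) {c : Fin r → Fin q} (hc : StrictMono c)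
    {σ : Equiv.Perm (Fin r)} (hσ : σ ≠ 1) :
    toLex (pathExponent hr (c ∘ σ)) < toLex (pathExponent hr c) := by
  classical
  -- the comparison is decided at the last index moved by `σ`
  obtain ⟨s, hs, hmax⟩ : ∃ s, σ s ≠ s ∧ ∀ t, s < t → σ t = t := by
    obtain ⟨x, hx⟩ : ∃ x, σ x ≠ x := by
      by_contra! h
      exact hσ (Equiv.ext h)
    let T : Finset (Fin r) := Finset.univ.filter fun t => σ t ≠ t
    have hT : T.Nonempty := ⟨x, by simpa [T] using hx⟩
    refine ⟨T.max' hT, by simpa [T] using T.max'_mem hT, fun t ht => ?_⟩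
    by_contra h
    exact absurd (T.le_max' t (by simpa [T] using h)) (not_le_of_gt ht)
  have hle : ∀ t ≤ s, σ t ≤ s := fun t ht => by
    by_contra! h
    exact absurd (σ.injective (hmax _ h)) (by lia)
  refine Finsupp.Lex.lt_iff.2 ⟨matVar (Fin.castLE hr s) (c s), fun u hu => ?_, ?_⟩
  · change pathExponent hr (c ∘ σ) u = pathExponent hr c u
    rw [← matVar_matRow_matCol u, matVar_lt] at hu
    rw [← matVar_matRow_matCol u]
    by_cases ha : (matRow u : ℕ) < r
    · obtain ⟨t, ht⟩ : ∃ t : Fin r, matRow u = Fin.castLE hr t := ⟨⟨matRow u, ha⟩, rfl⟩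
      rw [ht, pathExponent_castLE, pathExponent_castLE, Function.comp_apply]
      rw [ht] at hu
      by_cases hst : s < t
      · rw [hmax t hst]
      · push Not at hst
        have hcol : c s < matCol u := hu.resolve_right fun h => absurd h.2 (by
          rw [not_lt]
          exact hst)
        rw [if_neg ((hc.monotone (hle t hst)).trans_lt hcol).ne,
          if_neg ((hc.monotone hst).trans_lt hcol).ne]
    · rw [pathExponent_of_le hr _ _ (not_lt.1 ha), pathExponent_of_le hr _ _ (not_lt.1 ha)]
  · change pathExponent hr (c ∘ σ) _ < pathExponent hr c _
    rw [pathExponent_castLE, pathExponent_castLE, if_pos rfl, if_neg]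
    · exact zero_lt_one
    · exact fun h => hs (hc.injective h)

lemma coeff_initMinor {r : ℕ} (hr : r ≤ p) (c : Fin r → Fin q) (d : MatVar p q →₀ ℕ) :
    coeff d (initMinor r hr c) = ∑ σ : Equiv.Perm (Fin r),
      if pathExponent hr (c ∘ σ) = d then ((Equiv.Perm.sign σ : ℤ) : ℂ) else 0 := by
  rw [initMinor_eq_sum, coeff_sum]
  simp only [coeff_monomial]

lemma coeff_initMinor_pathExponent {r : ℕ} (hr : r ≤ p) {c : Fin r → Fin q}
    (hc : StrictMono c) : coeff (pathExponent hr c) (initMinor r hr c) = 1 := by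
  rw [coeff_initMinor, Finset.sum_eq_single 1]
  · simp
  · intro σ _ hσ
    rw [if_neg]
    intro h
    have := pathExponent_comp_perm_lt hr hc hσ
    rw [h] at this
    exact lt_irrefl _ this
  · simp

lemma degree_initMinor {r : ℕ} (hr : r ≤ p) {c : Fin r → Fin q} (hc : StrictMono c) :
    MonomialOrder.lex.degree (initMinor r hr c) = pathExponent hr c := by
  apply MonomialOrder.lex.toSyn.injective
  apply le_antisymm
  · rw [MonomialOrder.degree_le_iff]
    intro d hd
    rw [mem_support_iff, coeff_initMinor] at hd
    obtain ⟨σ, -, hσ⟩ := Finset.exists_ne_zero_of_sum_ne_zero hd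
    have hd : pathExponent hr (c ∘ σ) = d := by
      by_contra h
      exact hσ (if_neg h)
    rw [MonomialOrder.lex_le_iff, ← hd]
    by_cases h : σ = 1
    · subst h
      exact le_rfl
    · exact (pathExponent_comp_perm_lt hr hc h).le
  · refine MonomialOrder.lex.le_degree (mem_support_iff.2 ?_)
    rw [coeff_initMinor_pathExponent hr hc]
    exact one_ne_zero

lemma monic_initMinor {r : ℕ} (hr : r ≤ p) {c : Fin r → Fin q} (hc : StrictMono c) :
    MonomialOrder.lex.Monic (initMinor r hr c) := by
  rw [MonomialOrder.Monic, MonomialOrder.leadingCoeff, degree_initMinor hr hc,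
    coeff_initMinor_pathExponent hr hc]

/-- An exponent matrix whose consecutive rows satisfy the ballot inequalities; these are the
content matrices of semistandard tableaux. -/
def IsBallot (a : MatVar p q →₀ ℕ) : Prop :=
  ∀ i j : Fin p, (j : ℕ) = i + 1 → ∀ k : Fin q,
    ∑ l ∈ Finset.Iic k, a (matVar j l) ≤ ∑ l ∈ Finset.Iio k, a (matVar i l)

lemma IsBallot.exists_lt {a : MatVar p q →₀ ℕ} (ha : IsBallot a) {i j : Fin p}
    (hij : (j : ℕ) = i + 1) {k : Fin q} (hk : a (matVar j k) ≠ 0) :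
    ∃ l < k, a (matVar i l) ≠ 0 := by
  by_contra! h
  have h1 := ha i j hij k
  rw [Finset.sum_eq_zero (s := Finset.Iio k) fun l hl => h l (Finset.mem_Iio.1 hl),
    Nat.le_zero, Finset.sum_eq_zero_iff] at h1
  exact hk (h1 k (Finset.mem_Iic.2 le_rfl))

/-- Removal of the first column of the tableau: a nonzero ballot exponent is the sum of the
diagonal exponent of an initial minor and a ballot exponent. -/
lemma IsBallot.exists_eq_add {a : MatVar p q →₀ ℕ} (ha : IsBallot a) (h0 : a ≠ 0) :
    ∃ (r : ℕ) (hr : r ≤ p) (c : Fin r → Fin q) (b : MatVar p q →₀ ℕ),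
      0 < r ∧ StrictMono c ∧ IsBallot b ∧ a = pathExponent hr c + b := by
  classical
  -- `r` is the number of nonzero rows
  have hex : ∃ r : ℕ, ∀ i : Fin p, r ≤ i → ∀ k, a (matVar i k) = 0 :=
    ⟨p, fun i hi => absurd i.2 (not_lt.2 hi)⟩
  obtain ⟨r, hr0, hrmin⟩ : ∃ r : ℕ, (∀ i : Fin p, r ≤ i → ∀ k, a (matVar i k) = 0) ∧
      ∀ s < r, ∃ i : Fin p, s ≤ i ∧ ∃ k, a (matVar i k) ≠ 0 := by
    refine ⟨Nat.find hex, Nat.find_spec hex, fun s hs => ?_⟩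
    have := Nat.find_min hex hs
    push Not at this
    exact this
  have hr : r ≤ p := by
    by_contra! h
    obtain ⟨i, hi, -⟩ := hrmin p h
    exact absurd i.2 (not_lt.2 hi)
  have hdown : ∀ (m : ℕ) (i j : Fin p), (j : ℕ) = i + m → (∃ k, a (matVar j k) ≠ 0) →
      ∃ k, a (matVar i k) ≠ 0 := by
    intro m
    induction m with
    | zero =>
      intro i j hij h
      rwa [show i = j from Fin.ext hij.symm]
    | succ m ih =>
      rintro i j hij ⟨k, hk⟩
      obtain ⟨l, -, hl⟩ := ha.exists_lt (i := ⟨i + m, by lia⟩) (j := j) hij hk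
      exact ih i ⟨i + m, by lia⟩ rfl ⟨l, hl⟩
  have hne : ∀ t : Fin r, ∃ k, a (matVar (Fin.castLE hr t) k) ≠ 0 := fun t => by
    obtain ⟨i, hi, h⟩ := hrmin t t.2
    exact hdown (i - t) _ i (by simp; lia) h
  -- `c t` is the position of the first nonzero entry of row `t`
  have hmin : ∀ t : Fin r, ∃ k, a (matVar (Fin.castLE hr t) k) ≠ 0 ∧
      ∀ l < k, a (matVar (Fin.castLE hr t) l) = 0 := fun t => by
    obtain ⟨k, hk, hk'⟩ := WellFounded.has_min wellFounded_lt
      {k | a (matVar (Fin.castLE hr t) k) ≠ 0} (hne t)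
    exact ⟨k, hk, fun l hl => by_contra fun h => hk' l h hl⟩
  choose c hc hcmin using hmin
  have hrpos : 0 < r := by
    rw [Nat.pos_iff_ne_zero]
    rintro rfl
    exact h0 (Finsupp.ext fun v => hr0 (matRow v) (Nat.zero_le _) (matCol v))
  have hmono : StrictMono c := by
    obtain ⟨r, rfl⟩ := Nat.exists_eq_succ_of_ne_zero hrpos.ne'
    refine Fin.strictMono_iff_lt_succ.2 fun t => ?_
    obtain ⟨l, hl, hl'⟩ := ha.exists_lt (i := Fin.castLE hr t.castSucc)
      (j := Fin.castLE hr t.succ) (by simp) (hc t.succ)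
    refine lt_of_le_of_lt ?_ hl
    by_contra! h
    exact hl' (hcmin _ l h)
  have hle : pathExponent hr c ≤ a := by
    intro v
    rw [← matVar_matRow_matCol v]
    by_cases hv : (matRow v : ℕ) < r
    · obtain ⟨t, ht⟩ : ∃ t : Fin r, matRow v = Fin.castLE hr t := ⟨⟨matRow v, hv⟩, rfl⟩
      rw [ht, pathExponent_castLE]
      split_ifs with h
      · rw [← h]
        exact Nat.one_le_iff_ne_zero.2 (hc t)
      · exact Nat.zero_le _
    · rw [pathExponent_of_le hr _ _ (not_lt.1 hv)]
      exact Nat.zero_le _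
  have hab : a = pathExponent hr c + (a - pathExponent hr c) := (add_tsub_cancel_of_le hle).symm
  refine ⟨r, hr, c, a - pathExponent hr c, hrpos, hmono, ?_, hab⟩
  have hsum : ∀ (t : Fin r) (s : Finset (Fin q)),
      ∑ l ∈ s, a (matVar (Fin.castLE hr t) l) = (if c t ∈ s then 1 else 0) +
        ∑ l ∈ s, (a - pathExponent hr c) (matVar (Fin.castLE hr t) l) := by
    intro t s
    rw [← Finset.sum_ite_eq s (c t) fun _ => 1, ← Finset.sum_add_distrib]
    refine Finset.sum_congr rfl fun l _ => ?_
    conv_lhs => rw [hab]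
    rw [Finsupp.add_apply, pathExponent_castLE]
  intro i j hij k
  have hzero : ∀ s : Finset (Fin q), (∀ l ∈ s, a (matVar j l) = 0) →
      ∑ l ∈ s, (a - pathExponent hr c) (matVar j l) = 0 := fun s hs =>
    Finset.sum_eq_zero fun l hl => by rw [Finsupp.tsub_apply, hs l hl, Nat.zero_sub]
  by_cases hj : (j : ℕ) < r
  · obtain ⟨t, rfl⟩ : ∃ t : Fin r, j = Fin.castLE hr t := ⟨⟨j, hj⟩, rfl⟩
    obtain ⟨s, rfl⟩ : ∃ s : Fin r, i = Fin.castLE hr s := ⟨⟨i, by lia⟩, rfl⟩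
    have hst : c s < c t := hmono (by
      rw [Fin.lt_def]
      simp at hij
      lia)
    by_cases hk : c t ≤ k
    · have h1 := ha _ _ hij k
      rw [hsum, hsum, if_pos (Finset.mem_Iic.2 hk), if_pos (Finset.mem_Iio.2 (hst.trans_le hk))]
        at h1
      exact Nat.le_of_add_le_add_left h1
    · rw [hzero]
      · exact Nat.zero_le _
      · intro l hl
        exact hcmin t l ((Finset.mem_Iic.1 hl).trans_lt (not_le.1 hk))
  · rw [hzero]
    · exact Nat.zero_le _
    · exact fun l _ => hr0 j (not_lt.1 hj) l

/-- Every ballot exponent is the leading exponent of a product of initial minors. -/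
lemma IsBallot.exists_monic_of_degree_eq (S : Subalgebra ℂ (MvPolynomial (MatVar p q) ℂ))
    (hS : ∀ (r : ℕ) (hr : r ≤ p) (c : Fin r → Fin q), initMinor r hr c ∈ S)
    {a : MatVar p q →₀ ℕ} (ha : IsBallot a) :
    ∃ G ∈ S, MonomialOrder.lex.Monic G ∧ MonomialOrder.lex.degree G = a := by
  obtain ⟨N, hN⟩ : ∃ N, a.degree ≤ N := ⟨_, le_rfl⟩
  induction N generalizing a with
  | zero =>
    have h0 : a = 0 := (Finsupp.degree_eq_zero_iff a).1 (Nat.le_zero.1 hN)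
    exact ⟨1, S.one_mem, MonomialOrder.monic_one, by rw [MonomialOrder.degree_one, h0]⟩
  | succ N ih =>
    by_cases h0 : a = 0
    · exact ⟨1, S.one_mem, MonomialOrder.monic_one, by rw [MonomialOrder.degree_one, h0]⟩
    obtain ⟨r, hr, c, b, hrpos, hc, hb, rfl⟩ := ha.exists_eq_add h0
    have hdeg : (pathExponent hr c).degree = r := by
      rw [pathExponent, map_sum]
      simp
    rw [map_add, hdeg] at hN
    obtain ⟨G, hGS, hG, hGb⟩ := ih hb (by lia)
    refine ⟨initMinor r hr c * G, S.mul_mem (hS r hr c) hGS, (monic_initMinor hr hc).mul hG, ?_⟩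
    rw [MonomialOrder.degree_mul (monic_initMinor hr hc).ne_zero hG.ne_zero,
      degree_initMinor hr hc, hGb]

/-! ### Invariants of unipotent row operations -/

/-- The substitution that adds `t` times row `i` to row `j`. -/
noncomputable def rowAdd (i j : Fin p) (t : ℂ) :
    MvPolynomial (MatVar p q) ℂ →ₐ[ℂ] MvPolynomial (MatVar p q) ℂ :=
  aeval fun v => X v + if matRow v = j then C t * X (matVar i (matCol v)) else 0

/-- The one-parameter family `rowAdd i j t`, with `t` as an indeterminate. -/
noncomputable def genericRowAdd (i j : Fin p) :
    MvPolynomial (MatVar p q) ℂ →ₐ[ℂ] Polynomial (MvPolynomial (MatVar p q) ℂ) :=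
  aeval fun v => Polynomial.C (X v) +
    if matRow v = j then Polynomial.X * Polynomial.C (X (matVar i (matCol v))) else 0

lemma eval_genericRowAdd (i j : Fin p) (t : ℂ) (F : MvPolynomial (MatVar p q) ℂ) :
    (genericRowAdd i j F).eval (C t) = rowAdd i j t F := by
  induction F using MvPolynomial.induction_on with
  | C a =>
    rw [← algebraMap_eq, AlgHom.commutes, AlgHom.commutes, Polynomial.algebraMap_apply,
      Polynomial.eval_C]
  | add F G hF hG => rw [map_add, map_add, Polynomial.eval_add, hF, hG]
  | mul_X F v hF =>
    rw [map_mul, map_mul, Polynomial.eval_mul, hF]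
    congr 1
    rw [genericRowAdd, rowAdd, aeval_X, aeval_X, Polynomial.eval_add, Polynomial.eval_C]
    split_ifs
    · rw [Polynomial.eval_mul, Polynomial.eval_X, Polynomial.eval_C]
    · simp

lemma coeff_genericRowAdd (i j : Fin p) (F : MvPolynomial (MatVar p q) ℂ) :
    (genericRowAdd i j F).coeff 0 = F ∧
      (genericRowAdd i j F).coeff 1 = rowDer Finset.univ i j F := by
  induction F using MvPolynomial.induction_on with
  | C a =>
    rw [derivation_C, ← algebraMap_eq, AlgHom.commutes, Polynomial.algebraMap_apply,
      Polynomial.coeff_C_zero, Polynomial.coeff_C_succ]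
    exact ⟨rfl, rfl⟩
  | add F G hF hG =>
    rw [map_add, map_add, Polynomial.coeff_add, Polynomial.coeff_add, hF.1, hF.2, hG.1, hG.2]
    exact ⟨rfl, rfl⟩
  | mul_X F v hF =>
    have h0 : (genericRowAdd i j (X v)).coeff 0 = (X v : MvPolynomial (MatVar p q) ℂ) := by
      rw [genericRowAdd, aeval_X]
      split_ifs <;> simp
    have h1 : (genericRowAdd i j (X v)).coeff 1 = rowDer Finset.univ i j (X v) := by
      conv_rhs => rw [← matVar_matRow_matCol v, rowDer_X]
      rw [genericRowAdd, aeval_X]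
      split_ifs <;> simp_all [Polynomial.coeff_C]
    rw [map_mul, Polynomial.mul_coeff_zero, Polynomial.mul_coeff_one, Derivation.leibniz, h0, h1,
      hF.1, hF.2, smul_eq_mul, smul_eq_mul, mul_comm (X v)]
    exact ⟨rfl, rfl⟩

/-- Invariance under the one-parameter group of row operations implies invariance under its
Lie algebra. -/
lemma rowDer_eq_zero_of_rowAdd {i j : Fin p} {F : MvPolynomial (MatVar p q) ℂ}
    (hF : ∀ t, rowAdd i j t F = F) : rowDer Finset.univ i j F = 0 := by
  have h : genericRowAdd i j F = Polynomial.C F := by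
    refine Polynomial.eq_of_infinite_eval_eq _ _
      (Set.Infinite.mono ?_ (Set.infinite_range_of_injective (C_injective (MatVar p q) ℂ)))
    rintro _ ⟨t, rfl⟩
    change Polynomial.eval (C t) _ = Polynomial.eval (C t) _
    rw [eval_genericRowAdd, hF, Polynomial.eval_C]
  rw [← (coeff_genericRowAdd i j F).2, h, Polynomial.coeff_C_succ]

lemma rowAdd_initMinor {i j : Fin p} (hij : i < j) (t : ℂ) (r : ℕ) (hr : r ≤ p)
    (c : Fin r → Fin q) : rowAdd i j t (initMinor r hr c) = initMinor r hr c := by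
  classical
  rw [initMinor, AlgHom.map_det]
  by_cases hj : (j : ℕ) < r
  · obtain ⟨s, rfl⟩ : ∃ s : Fin r, j = Fin.castLE hr s := ⟨⟨j, hj⟩, rfl⟩
    have hi : (i : ℕ) < r := lt_trans hij hj
    obtain ⟨u, rfl⟩ : ∃ u : Fin r, i = Fin.castLE hr u := ⟨⟨i, hi⟩, rfl⟩
    have hsu : s ≠ u := by
      rintro rfl
      exact lt_irrefl _ hij
    conv_rhs => rw [← Matrix.det_updateCol_add_smul_self _ hsu (C t)]
    congr 1
    ext x y : 2
    rw [Matrix.updateCol_apply]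
    split_ifs with h
    · simp [rowAdd, h]
    · simp [rowAdd, h]
  · congr 1
    ext x y : 2
    have : Fin.castLE hr y ≠ j := by
      rintro rfl
      exact hj y.2
    simp [rowAdd, this]

/-- The first fundamental theorem for the group of lower unipotent matrices: a polynomial in the
entries of a `p × q` matrix that is invariant under adding a multiple of a row to the next one is
a polynomial in the initial minors. -/
theorem mem_adjoin_initMinor {F : MvPolynomial (MatVar p q) ℂ}
    (hF : ∀ i j : Fin p, (j : ℕ) = i + 1 → ∀ t, rowAdd i j t F = F) :
    F ∈ Algebra.adjoin ℂ {G | ∃ (r : ℕ) (hr : r ≤ p) (c : Fin r → Fin q), G = initMinor r hr c} := by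
  set S := Algebra.adjoin ℂ
    {G | ∃ (r : ℕ) (hr : r ≤ p) (c : Fin r → Fin q), G = initMinor r hr c} with hS
  have hmem : ∀ (r : ℕ) (hr : r ≤ p) (c : Fin r → Fin q), initMinor r hr c ∈ S :=
    fun r hr c => Algebra.subset_adjoin ⟨r, hr, c, rfl⟩
  have hinv : ∀ G ∈ S, ∀ i j : Fin p, (j : ℕ) = i + 1 → ∀ t, rowAdd i j t G = G := by
    intro G hG i j hij t
    have hle : S ≤ AlgHom.equalizer (rowAdd i j t) (AlgHom.id ℂ _) := by
      rw [hS, Algebra.adjoin_le_iff]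
      rintro _ ⟨r, hr, c, rfl⟩
      exact rowAdd_initMinor (Fin.lt_def.2 (by lia)) t r hr c
    exact hle hG
  -- well-founded induction on the leading exponent
  obtain ⟨a, ha⟩ : ∃ a, a = MonomialOrder.lex.toSyn (MonomialOrder.lex.degree F) := ⟨_, rfl⟩
  induction a using WellFoundedLT.induction generalizing F with
  | ind a ih =>
    by_cases h0 : F = 0
    · rw [h0]
      exact S.zero_mem
    have hballot : IsBallot (MonomialOrder.lex.degree F) := fun i j hij k =>
      sum_lex_degree_le (Fin.lt_def.2 (by lia)) h0 (rowDer_eq_zero_of_rowAdd (hF i j hij)) k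
    obtain ⟨G, hGS, hG, hGF⟩ := hballot.exists_monic_of_degree_eq S hmem
    have hGc : MonomialOrder.lex.degree (MonomialOrder.lex.leadingCoeff F • G) =
        MonomialOrder.lex.degree F := by
      rw [← hGF]
      exact MonomialOrder.degree_smul_of_isRegular
        (IsRegular.of_ne_zero (MonomialOrder.leadingCoeff_ne_zero_iff.2 h0))
    have hcS : MonomialOrder.lex.leadingCoeff F • G ∈ S := S.smul_mem hGS _
    set H := F - MonomialOrder.lex.leadingCoeff F • G with hH
    have hFH : F = H + MonomialOrder.lex.leadingCoeff F • G := by rw [hH, sub_add_cancel]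
    rw [hFH]
    refine S.add_mem ?_ hcS
    have hHinv : ∀ i j : Fin p, (j : ℕ) = i + 1 → ∀ t, rowAdd i j t H = H := by
      intro i j hij t
      rw [hH, map_sub, hF i j hij, hinv _ hcS i j hij]
    have hcoeff : coeff (MonomialOrder.lex.degree F) H = 0 := by
      rw [hH, coeff_sub, coeff_smul, ← hGF, hG.coeff_degree, hGF, smul_eq_mul, mul_one]
      exact sub_self _
    by_cases hH0 : H = 0
    · rw [hH0]
      exact S.zero_mem
    refine ih _ ?_ hHinv rfl
    rw [ha]
    refine lt_of_le_of_ne ?_ ?_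
    · refine MonomialOrder.degree_sub_le.trans ?_
      rw [hGc, sup_idem]
    · intro h
      rw [← MonomialOrder.lex.toSyn.injective h] at hcoeff
      exact MonomialOrder.coeff_degree_ne_zero_iff.2 hH0 hcoeff

end RowOperations

section Jets

open scoped Topology

variable {n : ℕ}

/-! ### Jets of polynomial curves -/

/-- The jet at `s` of the curve with polynomial components `g i`. -/
noncomputable def polyJet (g : Fin n → Polynomial ℂ) (s : ℂ) (v : Fin n × ℕ) : ℂ :=
  (Polynomial.derivative^[v.2] (g v.1)).eval s

lemma iteratedDeriv_polynomial_eval (g : Polynomial ℂ) (l : ℕ) :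
    iteratedDeriv l (fun s => g.eval s) = fun s => (Polynomial.derivative^[l] g).eval s := by
  induction l with
  | zero => rw [iteratedDeriv_zero, Function.iterate_zero_apply]
  | succ l ih =>
    rw [iteratedDeriv_succ, ih, Function.iterate_succ_apply']
    ext s
    rw [Polynomial.deriv]

lemma jet_polynomial (g : Fin n → Polynomial ℂ) :
    jet (fun i s => (g i).eval s) = polyJet g 0 := by
  ext v
  rw [jet, iteratedDeriv_polynomial_eval, polyJet]

lemma exists_polyJet_eq (z : Fin n × ℕ → ℂ) (N : ℕ) :
    ∃ g : Fin n → Polynomial ℂ, ∀ v, v.2 ≤ N → polyJet g 0 v = z v := by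
  refine ⟨fun i => ∑ l ∈ Finset.range (N + 1), Polynomial.monomial l (z (i, l) / l.factorial),
    fun v hv => ?_⟩
  rw [polyJet, ← Polynomial.coeff_zero_eq_eval_zero, Polynomial.coeff_iterate_derivative,
    Polynomial.finsetSum_coeff, zero_add, Nat.descFactorial_self, Finset.sum_eq_single v.2]
  · rw [Polynomial.coeff_monomial, if_pos rfl, nsmul_eq_mul]
    exact mul_div_cancel₀ _ (Nat.cast_ne_zero.2 (Nat.factorial_ne_zero _))
  · intro l _ hl
    rw [Polynomial.coeff_monomial, if_neg hl]
  · intro h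
    exact absurd (Finset.mem_range.2 (Nat.lt_succ_of_le hv)) h

lemma eval_eq_of_mem_supported {σ : Type*} {s : Set σ} {P : MvPolynomial σ ℂ}
    (hP : P ∈ supported ℂ s) {z z' : σ → ℂ} (h : ∀ v ∈ s, z v = z' v) : eval z P = eval z' P := by
  rw [supported_eq_range_rename] at hP
  obtain ⟨P, rfl⟩ := hP
  change eval z (rename _ P) = eval z' (rename _ P)
  rw [eval_rename, eval_rename]
  congr 1
  refine congrArg _ (funext fun v => h v v.2)

lemma eval_aeval {σ τ : Type*} (z : τ → ℂ) (f : σ → MvPolynomial τ ℂ) (P : MvPolynomial σ ℂ) :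
    eval z (aeval f P) = eval (fun v => eval z (f v)) P := by
  induction P using MvPolynomial.induction_on with
  | C a => simp
  | add P Q hP hQ => rw [map_add, map_add, map_add, hP, hQ]
  | mul_X P v hP => rw [map_mul, map_mul, map_mul, hP, aeval_X, eval_X]

lemma exists_order_le (P : JetPoly n) : ∃ N, P ∈ supported ℂ {v : Fin n × ℕ | v.2 ≤ N} :=
  ⟨P.vars.sup Prod.snd, mem_supported.2 fun _ hv => Finset.le_sup (f := Prod.snd) hv⟩

/-- Any finite family of polynomials cannot distinguish a sequence of jet coordinates from the jet
of a suitable polynomial curve. -/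
lemma exists_curve_eval_eq {ι : Type*} [Fintype ι] (Q : ι → JetPoly n) (z : Fin n × ℕ → ℂ) :
    ∃ g : Fin n → Polynomial ℂ, ∀ a, eval (polyJet g 0) (Q a) = eval z (Q a) := by
  choose N hN using fun a => exists_order_le (Q a)
  obtain ⟨g, hg⟩ := exists_polyJet_eq z (Finset.univ.sup N)
  exact ⟨g, fun a => eval_eq_of_mem_supported (hN a) fun v hv =>
    hg v (le_trans hv (Finset.le_sup (Finset.mem_univ a)))⟩

lemma hasDerivAt_eval_polyJet (g : Fin n → Polynomial ℂ) (P : JetPoly n) (s : ℂ) :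
    HasDerivAt (fun s => eval (polyJet g s) P) (eval (polyJet g s) (totalD n P)) s := by
  induction P using MvPolynomial.induction_on with
  | C a =>
    rw [derivation_C, map_zero]
    simpa using hasDerivAt_const s a
  | add P Q hP hQ =>
    simp only [map_add]
    exact hP.add hQ
  | mul_X P v hP =>
    have hX : HasDerivAt (fun s => eval (polyJet g s) (X v)) (eval (polyJet g s)
        (totalD n (X v))) s := by
      simp only [totalD, mkDerivation_X, eval_X, polyJet]
      rw [Function.iterate_succ_apply']
      exact Polynomial.hasDerivAt _ _
    convert! hP.mul hX using 1
    · ext s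
      simp
    · rw [Derivation.leibniz, smul_eq_mul, smul_eq_mul, map_add, map_mul, map_mul]
      ring

/-! ### Homogeneity -/

lemma coeff_aeval_scale {σ : Type*} (w : σ → ℕ) (s : ℂ) (P : MvPolynomial σ ℂ) :
    ∀ d, coeff d (aeval (fun v => C (s ^ w v) * X v : σ → MvPolynomial σ ℂ) P) =
      s ^ Finsupp.weight w d * coeff d P := by
  classical
  induction P using MvPolynomial.induction_on with
  | C a =>
    intro d
    rw [← algebraMap_eq, AlgHom.commutes, algebraMap_eq, coeff_C]
    split_ifs with h
    · simp [← h]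
    · simp
  | add P Q hP hQ =>
    intro d
    rw [map_add, coeff_add, coeff_add, hP, hQ, mul_add]
  | mul_X P v hP =>
    intro d
    rw [map_mul, aeval_X, ← mul_assoc, mul_comm _ (C _), mul_assoc, coeff_C_mul, coeff_mul_X',
      coeff_mul_X']
    split_ifs with h
    · rw [hP, ← Finsupp.weight_sub_single_add (w := w) (Finsupp.mem_support_iff.1 h)]
      ring
    · simp

/-- Invariance under the homotheties of `ℂ` says that a reparametrization invariant is weighted
homogeneous, the variable `f_i^{(l)}` having weight `l`. -/
lemma IsReparamInvariant.isWeightedHomogeneous {m : ℕ} {P : JetPoly n}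
    (hP : IsReparamInvariant m P) : IsWeightedHomogeneous (fun v : Fin n × ℕ => v.2) P m := by
  have h : aeval (fun v => C ((2 : ℂ) ^ v.2) * X v : Fin n × ℕ → JetPoly n) P =
      C ((2 : ℂ) ^ m) * P := by
    refine MvPolynomial.funext fun z => ?_
    obtain ⟨g, hg⟩ := exists_curve_eval_eq (fun a : Bool => cond a P
      (aeval (fun v => C ((2 : ℂ) ^ v.2) * X v : Fin n × ℕ → JetPoly n) P)) z
    have h1 : eval (polyJet g 0) P = eval z P := hg true
    have h2 : eval (polyJet g 0) (aeval (fun v => C ((2 : ℂ) ^ v.2) * X v :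
      Fin n × ℕ → JetPoly n) P) = eval z (aeval (fun v => C ((2 : ℂ) ^ v.2) * X v :
      Fin n × ℕ → JetPoly n) P) := hg false
    have hd : HasDerivAt (fun s : ℂ => 2 * s) 2 0 := by
      simpa using (hasDerivAt_id (0 : ℂ)).const_mul 2
    have h3 := hP (fun i s => (g i).eval s) (fun s => 2 * s)
      (fun i => (g i).differentiable.analyticAt 0)
      (by fun_prop) (by simp) (by rw [hd.deriv]; norm_num)
    rw [jet_polynomial, hd.deriv, h1] at h3
    rw [map_mul, eval_C, ← h3, ← h2, eval_aeval]
    refine congrArg (fun x => eval x P) (funext fun v => ?_)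
    have h4 := congrFun (iteratedDeriv_comp_const_mul (n := v.2)
      (f := fun s : ℂ => (g v.1).eval s) (g v.1).differentiable.contDiff 2) 0
    rw [map_mul, eval_C, eval_X, jet]
    refine Eq.trans ?_ h4.symm
    rw [iteratedDeriv_polynomial_eval, mul_zero]
    rfl
  intro d hd
  have h1 := coeff_aeval_scale (fun v : Fin n × ℕ => v.2) 2 P d
  rw [h, coeff_C_mul] at h1
  have h2 := mul_right_cancel₀ hd h1
  have h3 : (2 : ℕ) ^ m = 2 ^ (Finsupp.weight (fun v : Fin n × ℕ => v.2) d) := by exact_mod_cast h2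
  exact (Nat.pow_right_injective le_rfl h3).symm

/-! ### Reparametrization by the first component -/

section Reparametrization

variable [NeZero n]

/-- The jet coordinates of the curve `f ∘ f₁⁻¹`, in terms of the jet coordinates `z` of `f`. -/
noncomputable def normalizedJet (z : Fin n × ℕ → ℂ) (v : Fin n × ℕ) : ℂ :=
  if v.1 = 0 then (if v.2 = 1 then 1 else 0)
  else if v.2 = 1 then z (v.1, 1) / z (0, 1)
  else eval z (initInv v.1 (v.2 - 2)) / z (0, 1) ^ (2 * (v.2 - 2) + 3)

variable {g : Fin n → Polynomial ℂ} {φ : ℂ → ℂ}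

/-- Derivative of a quotient `A / (f₁')^N` along `f ∘ f₁⁻¹`; it is the reason for the form of the
bracket with `f₁'`. -/
lemma hasDerivAt_eval_div_pow {y : ℂ} (ha : polyJet g (φ y) (0, 1) ≠ 0)
    (hφ : HasDerivAt φ (polyJet g (φ y) (0, 1))⁻¹ y) (A : JetPoly n) (N : ℕ) :
    HasDerivAt (fun y => eval (polyJet g (φ y)) A / polyJet g (φ y) (0, 1) ^ N)
      (eval (polyJet g (φ y)) (bracket N 1 A (X (0, 1))) / polyJet g (φ y) (0, 1) ^ (N + 2)) y := by
  have h1 := (hasDerivAt_eval_polyJet g A (φ y)).comp y hφ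
  have h2 := (hasDerivAt_eval_polyJet g (X (0, 1)) (φ y)).comp y hφ
  have h3 := h1.div (h2.pow N) (pow_ne_zero _ (by simpa using ha))
  convert! h3 using 1
  · ext y
    simp
  · simp only [bracket, totalD, mkDerivation_X, map_sub, map_mul, map_natCast, eval_X,
      Function.comp_apply, Pi.pow_apply]
    cases N with
    | zero =>
      field_simp
      simp
      ring
    | succ N =>
      rw [Nat.add_sub_cancel]
      push_cast
      field_simp
      ring

lemma iteratedDeriv_one_comp_eventuallyEq
    (hev : ∀ᶠ y in 𝓝 (0 : ℂ), polyJet g (φ y) (0, 1) ≠ 0 ∧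
      HasDerivAt φ (polyJet g (φ y) (0, 1))⁻¹ y) (i : Fin n) :
    iteratedDeriv 1 ((fun s => (g i).eval s) ∘ φ) =ᶠ[𝓝 0] fun y =>
      eval (polyJet g (φ y)) (X (i, 1)) / polyJet g (φ y) (0, 1) ^ 1 := by
  filter_upwards [hev] with y hy
  rw [iteratedDeriv_one, eval_X, pow_one, div_eq_mul_inv]
  exact (((g i).hasDerivAt (φ y)).comp y hy.2).deriv

lemma iteratedDeriv_comp_eventuallyEq
    (hev : ∀ᶠ y in 𝓝 (0 : ℂ), polyJet g (φ y) (0, 1) ≠ 0 ∧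
      HasDerivAt φ (polyJet g (φ y) (0, 1))⁻¹ y) (i : Fin n) (k : ℕ) :
    iteratedDeriv (k + 2) ((fun s => (g i).eval s) ∘ φ) =ᶠ[𝓝 0] fun y =>
      eval (polyJet g (φ y)) (initInv i k) / polyJet g (φ y) (0, 1) ^ (2 * k + 3) := by
  induction k with
  | zero =>
    rw [iteratedDeriv_succ]
    filter_upwards [(iteratedDeriv_one_comp_eventuallyEq hev i).deriv, hev] with y hy hy'
    rw [hy]
    exact (hasDerivAt_eval_div_pow hy'.1 hy'.2 (X (i, 1)) 1).deriv
  | succ k ih =>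
    rw [iteratedDeriv_succ]
    filter_upwards [ih.deriv, hev] with y hy hy'
    rw [hy]
    exact (hasDerivAt_eval_div_pow hy'.1 hy'.2 (initInv i k) (2 * k + 3)).deriv

/-- The value of a reparametrization invariant on a curve `f` with `f₁'(0) ≠ 0` is determined by
its value on `f ∘ f₁⁻¹`. -/
theorem IsReparamInvariant.eval_eq_mul_eval_normalizedJet {κ m : ℕ} {P : JetPoly n}
    (hP : IsReparamInvariant m P) (hκ : IsJetPolyOfOrder n κ P) (z : Fin n × ℕ → ℂ)
    (hz : z (0, 1) ≠ 0) : eval z P = z (0, 1) ^ m * eval (normalizedJet z) P := by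
  obtain ⟨g, hg⟩ := exists_curve_eval_eq (Sum.elim (fun _ : Unit => P)
    (Sum.elim (fun i : Fin n => X (i, 1)) fun x : Fin n × Fin κ => initInv x.1 x.2)) z
  have hgP : eval (polyJet g 0) P = eval z P := hg (Sum.inl ())
  have hg1 : ∀ i, polyJet g 0 (i, 1) = z (i, 1) := fun i => by
    simpa using hg (Sum.inr (Sum.inl i))
  have hgk : ∀ i k, k < κ → eval (polyJet g 0) (initInv i k) = eval z (initInv i k) :=
    fun i k hk => hg (Sum.inr (Sum.inr (i, ⟨k, hk⟩)))
  -- `φ` is the local inverse of the first component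
  let F : ℂ → ℂ := fun s => (g 0).eval s - (g 0).eval 0
  have hF : ∀ s, HasDerivAt F (polyJet g s (0, 1)) s := fun s =>
    ((g 0).hasDerivAt s).sub_const _
  have hF0 : F 0 = 0 := sub_self _
  have hFa : AnalyticAt ℂ F 0 :=
    (Differentiable.analyticAt (fun s => (hF s).differentiableAt) 0)
  have hF' : deriv F 0 ≠ 0 := by rw [(hF 0).deriv, hg1]; exact hz
  obtain ⟨φ, hφa, hφ0, hφF⟩ : ∃ φ : ℂ → ℂ, AnalyticAt ℂ φ 0 ∧ φ 0 = 0 ∧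
      ∀ᶠ y in 𝓝 0, F (φ y) = y := by
    refine ⟨hFa.hasStrictDerivAt.localInverse _ _ _ hF', ?_, ?_, ?_⟩
    · have := hFa.analyticAt_localInverse hF'
      rwa [hF0] at this
    · have := HasStrictFDerivAt.localInverse_apply_image
        (hFa.hasStrictDerivAt.hasStrictFDerivAt_equiv hF')
      rwa [hF0] at this
    · have := HasStrictFDerivAt.eventually_right_inverse
        (hFa.hasStrictDerivAt.hasStrictFDerivAt_equiv hF')
      rwa [hF0] at this
  have hcont : ContinuousAt (fun y => polyJet g (φ y) (0, 1)) 0 :=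
    (Polynomial.continuous _).continuousAt.comp hφa.continuousAt
  have hev : ∀ᶠ y in 𝓝 (0 : ℂ), polyJet g (φ y) (0, 1) ≠ 0 ∧
      HasDerivAt φ (polyJet g (φ y) (0, 1))⁻¹ y := by
    have h1 : ∀ᶠ y in 𝓝 (0 : ℂ), polyJet g (φ y) (0, 1) ≠ 0 :=
      hcont.eventually_ne (by rw [hφ0, hg1]; exact hz)
    filter_upwards [h1, hφa.eventually_analyticAt, hφF.eventually_nhds] with y hy1 hy2 hy3
    refine ⟨hy1, ?_⟩
    have h2 := hy2.differentiableAt.hasDerivAt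
    have h3 := (hF (φ y)).comp y h2
    have h4 : HasDerivAt (F ∘ φ) 1 y := (hasDerivAt_id y).congr_of_eventuallyEq hy3
    rwa [eq_inv_of_mul_eq_one_right (h3.unique h4)] at h2
  have hφ' : deriv φ 0 = (z (0, 1))⁻¹ := by
    rw [hev.self_of_nhds.2.deriv, hφ0, hg1]
  have hjet : ∀ v ∈ {v : Fin n × ℕ | 1 ≤ v.2 ∧ v.2 ≤ κ},
      jet (fun i => (fun s => (g i).eval s) ∘ φ) v = normalizedJet z v := by
    rintro ⟨i, l⟩ ⟨hl1, hl2⟩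
    change iteratedDeriv l ((fun s => (g i).eval s) ∘ φ) 0 = _
    obtain ⟨l, rfl⟩ : ∃ l', l = l' + 1 := ⟨l - 1, (Nat.sub_add_cancel hl1).symm⟩
    by_cases hi : i = 0
    · subst hi
      have h1 : (fun s => (g 0).eval s) ∘ φ =ᶠ[𝓝 0] fun y => y + (g 0).eval 0 := by
        filter_upwards [hφF] with y hy
        rw [Function.comp_apply, ← sub_eq_iff_eq_add]
        exact hy
      rw [h1.iteratedDeriv_eq, iteratedDeriv_succ']
      have h2 : deriv (fun y : ℂ => y + (g 0).eval 0) = fun _ => 1 := by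
        ext y
        simp
      rw [h2, iteratedDeriv_const, normalizedJet, if_pos rfl]
      simp
    · cases l with
      | zero =>
        rw [(iteratedDeriv_one_comp_eventuallyEq hev i).eq_of_nhds, normalizedJet, if_neg hi,
          if_pos rfl, hφ0, eval_X, hg1, hg1, pow_one]
      | succ k =>
        rw [(iteratedDeriv_comp_eventuallyEq hev i k).eq_of_nhds, normalizedJet, if_neg hi,
          if_neg (by simp), hφ0, hg1, hgk _ _ (by lia)]
        rfl
  have key := hP (fun i s => (g i).eval s) φ (fun i => (g i).differentiable.analyticAt 0) hφa hφ0
    (by rw [hφ']; exact inv_ne_zero hz)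
  rw [jet_polynomial, hgP, hφ', eval_eq_of_mem_supported hκ hjet, inv_pow] at key
  rw [key, mul_inv_cancel_left₀ (pow_ne_zero _ hz)]

end Reparametrization

end Jets

/-! ### Restriction to normalized curves -/

section Slice

variable {p q : ℕ}

/-- The jet coordinates of a normalized curve: `f₁' = 1`, the other first derivatives and the
higher derivatives of `f₁` vanish, and the derivative of order `k + 2` of the component with index
`i + 1` in `Fin (p + 1)` is the indeterminate in row `i` and column `k` of a `p × q` matrix. The
remaining coordinates, which do not occur in jets of order `q + 1`, are set to `0`. -/
noncomputable def sliceCoord (v : Fin (p + 1) × ℕ) : MvPolynomial (MatVar p q) ℂ :=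
  Fin.cases (if v.2 = 1 then 1 else 0)
    (fun i => if h : 2 ≤ v.2 ∧ v.2 - 2 < q then X (matVar i ⟨v.2 - 2, h.2⟩) else 0) v.1

lemma sliceCoord_zero (l : ℕ) :
    sliceCoord (p := p) (q := q) (0, l) = if l = 1 then 1 else 0 := rfl

lemma sliceCoord_succ (i : Fin p) (l : ℕ) : sliceCoord (q := q) (i.succ, l) =
    if h : 2 ≤ l ∧ l - 2 < q then X (matVar i ⟨l - 2, h.2⟩) else 0 := rfl

/-- The restriction of an invariant of the unipotent group to normalized curves is invariant under
the row operations that do not involve the first component. -/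
lemma rowAdd_aeval_sliceCoord {P : JetPoly (p + 1)}
    (hP : ∀ u : Matrix (Fin (p + 1)) (Fin (p + 1)) ℂ, IsLowerUnipotent u → linAct u P = P)
    {i j : Fin p} (hij : i < j) (t : ℂ) :
    rowAdd (q := q) i j t (aeval sliceCoord P) = aeval sliceCoord P := by
  let u : Matrix (Fin (p + 1)) (Fin (p + 1)) ℂ := fun a b =>
    (if b = a then 1 else 0) + if b = i.succ then (if a = j.succ then t else 0) else 0
  have hu : IsLowerUnipotent u := by
    constructor
    · intro a
      have : ¬(a = i.succ ∧ a = j.succ) := by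
        rintro ⟨rfl, h⟩
        exact hij.ne (Fin.succ_injective _ h)
      by_cases h : a = i.succ
      · simp [u, h, hij.ne]
      · simp [u, h]
    · intro a b hab
      have h1 : b ≠ a := hab.ne'
      by_cases h : b = i.succ
      · have : a ≠ j.succ := by
          rintro rfl
          rw [h, Fin.succ_lt_succ_iff] at hab
          exact lt_asymm hij hab
        simp [u, h1, this]
      · simp [u, h1, h]
  have h : (aeval sliceCoord : JetPoly (p + 1) →ₐ[ℂ] MvPolynomial (MatVar p q) ℂ).comp
      (linAct u) = (rowAdd i j t).comp (aeval sliceCoord) := by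
    refine algHom_ext fun v => ?_
    obtain ⟨a, l⟩ := v
    rw [AlgHom.comp_apply, AlgHom.comp_apply, linAct, aeval_X, aeval_X, map_sum]
    simp only [map_mul, aeval_X, u, map_add, apply_ite C, add_mul, ite_mul, one_mul,
      zero_mul, Finset.sum_add_distrib, Finset.sum_ite_eq', Finset.mem_univ, if_true,
      apply_ite (aeval sliceCoord : JetPoly (p + 1) →ₐ[ℂ] MvPolynomial (MatVar p q) ℂ), map_one,
      map_zero]
    refine Fin.cases ?_ (fun r => ?_) a
    · rw [if_neg (Fin.succ_ne_zero j).symm, add_zero, sliceCoord_zero]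
      split_ifs <;> simp
    · rw [sliceCoord_succ, sliceCoord_succ]
      by_cases hr : r = j
      · subst hr
        rw [if_pos rfl]
        split_ifs <;> simp [rowAdd, ← algebraMap_eq]
      · split_ifs <;> simp_all [rowAdd]
  calc rowAdd i j t (aeval sliceCoord P) = aeval sliceCoord (linAct u P) :=
        (DFunLike.congr_fun h P).symm
    _ = aeval sliceCoord P := by rw [hP u hu]

/-- The coordinates of the normalized curve attached to the jet coordinates `z`. -/
noncomputable def slicePoint (q : ℕ) (z : Fin (p + 1) × ℕ → ℂ) (v : MatVar p q) : ℂ :=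
  eval z (initInv (matRow v).succ (matCol v)) / z (0, 1) ^ (2 * (matCol v : ℕ) + 3)

/-- A unipotent matrix, depending on the curve, removes the first derivatives of all components
but the first. -/
lemma eval_normalizedJet {κ : ℕ} {P : JetPoly (p + 1)} (hκ : IsJetPolyOfOrder (p + 1) κ P)
    (hP : ∀ u : Matrix (Fin (p + 1)) (Fin (p + 1)) ℂ, IsLowerUnipotent u → linAct u P = P)
    (z : Fin (p + 1) × ℕ → ℂ) :
    eval (normalizedJet z) P = eval (slicePoint (κ - 1) z) (aeval sliceCoord P) := by
  let u : Matrix (Fin (p + 1)) (Fin (p + 1)) ℂ := fun a b =>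
    (if b = a then 1 else 0) + if b = 0 then (if a = 0 then 0 else - normalizedJet z (a, 1)) else 0
  have hu : IsLowerUnipotent u := by
    constructor
    · intro a
      by_cases h : a = 0 <;> simp [u, h]
    · intro a b hab
      have h1 : b ≠ a := hab.ne'
      have h2 : b ≠ 0 := ((Fin.zero_le a).trans_lt hab).ne'
      simp [u, h1, h2]
  conv_lhs => rw [← hP u hu, linAct, eval_aeval]
  rw [eval_aeval]
  refine eval_eq_of_mem_supported hκ ?_
  rintro ⟨a, l⟩ ⟨hl1, hl2⟩
  dsimp only at hl1 hl2
  simp only [map_sum, map_mul, eval_C, eval_X, u, add_mul, ite_mul, one_mul, zero_mul,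
    Finset.sum_add_distrib, Finset.sum_ite_eq', Finset.mem_univ, if_true]
  revert a
  refine Fin.cases ?_ (fun i => ?_)
  · rw [if_pos rfl, add_zero, sliceCoord_zero, normalizedJet, if_pos rfl]
    split_ifs <;> simp
  · rw [if_neg (Fin.succ_ne_zero i), sliceCoord_succ]
    by_cases hl : l = 1
    · subst hl
      simp [normalizedJet]
    · have h2 : 2 ≤ l ∧ l - 2 < κ - 1 := by omega
      rw [dif_pos h2, eval_X]
      simp [normalizedJet, slicePoint, hl]

end Slice

/-! ### Weights -/

section Weights

variable {σ τ : Type*}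

/-- All exponents of `Q` have weight at most `N`. -/
def WeightLE (w : τ → ℕ) (N : ℕ) (Q : MvPolynomial τ ℂ) : Prop :=
  ∀ d, coeff d Q ≠ 0 → Finsupp.weight w d ≤ N

lemma WeightLE.one (w : τ → ℕ) : WeightLE w 0 1 := fun _ hd =>
  (isWeightedHomogeneous_one ℂ w hd).le

lemma WeightLE.mul {w : τ → ℕ} {M N : ℕ} {P Q : MvPolynomial τ ℂ} (hP : WeightLE w M P)
    (hQ : WeightLE w N Q) : WeightLE w (M + N) (P * Q) := by
  classical
  intro d hd
  rw [coeff_mul] at hd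
  obtain ⟨⟨a, b⟩, hab, h⟩ := Finset.exists_ne_zero_of_sum_ne_zero hd
  rw [← Finset.HasAntidiagonal.mem_antidiagonal.1 hab, map_add]
  exact add_le_add (hP a (left_ne_zero_of_mul h)) (hQ b (right_ne_zero_of_mul h))

lemma WeightLE.aeval_monomial {w : σ → ℕ} {w' : τ → ℕ} {f : σ → MvPolynomial τ ℂ}
    (hf : ∀ v, WeightLE w' (w v) (f v)) (d : σ →₀ ℕ) :
    WeightLE w' (Finsupp.weight w d) (aeval f (monomial d (1 : ℂ))) := by
  induction d using Finsupp.induction_linear with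
  | zero =>
    rw [show (monomial (0 : σ →₀ ℕ) (1 : ℂ)) = 1 from rfl, map_one, map_zero]
    exact WeightLE.one w'
  | add d e hd he =>
    have h : (monomial (d + e) (1 : ℂ)) = monomial d 1 * monomial e 1 := by
      rw [monomial_mul, one_mul]
    rw [h, map_mul, map_add]
    exact hd.mul he
  | single v k =>
    rw [← X_pow_eq_monomial, map_pow, aeval_X, Finsupp.weight_single]
    induction k with
    | zero =>
      rw [pow_zero, zero_smul]
      exact WeightLE.one w'
    | succ k ih =>
      rw [pow_succ, add_smul, one_smul]
      exact ih.mul (hf v)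

lemma eq_sum_smul_monomial (P : MvPolynomial σ ℂ) :
    P = ∑ d ∈ P.support, coeff d P • monomial d (1 : ℂ) := by
  conv_lhs => rw [P.as_sum]
  refine Finset.sum_congr rfl fun d _ => ?_
  rw [smul_monomial, smul_eq_mul, mul_one]

lemma WeightLE.aeval {w : σ → ℕ} {w' : τ → ℕ} {f : σ → MvPolynomial τ ℂ}
    (hf : ∀ v, WeightLE w' (w v) (f v)) {m : ℕ} {P : MvPolynomial σ ℂ}
    (hP : IsWeightedHomogeneous w P m) : WeightLE w' m (aeval f P) := by
  intro d hd
  rw [eq_sum_smul_monomial P, map_sum, coeff_sum] at hd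
  obtain ⟨e, he, h⟩ := Finset.exists_ne_zero_of_sum_ne_zero hd
  rw [map_smul, coeff_smul, smul_eq_mul] at h
  rw [← hP (mem_support_iff.1 he)]
  exact WeightLE.aeval_monomial hf e d (right_ne_zero_of_mul h)

lemma isWeightedHomogeneous_aeval_monomial {w : σ → ℕ} {w' : τ → ℕ} {f : σ → MvPolynomial τ ℂ}
    (hf : ∀ v, IsWeightedHomogeneous w' (f v) (w v)) (d : σ →₀ ℕ) :
    IsWeightedHomogeneous w' (aeval f (monomial d (1 : ℂ))) (Finsupp.weight w d) := by
  rw [MvPolynomial.aeval_monomial, map_one, one_mul, Finsupp.weight_apply]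
  exact IsWeightedHomogeneous.prod _ _ _ fun v _ => (hf v).pow _

/-- A substitution of homogeneous polynomials is compatible with the homogeneous components. -/
lemma weightedHomogeneousComponent_aeval {w : σ → ℕ} {w' : τ → ℕ} {f : σ → MvPolynomial τ ℂ}
    (hf : ∀ v, IsWeightedHomogeneous w' (f v) (w v)) (N : ℕ) (P : MvPolynomial σ ℂ) :
    weightedHomogeneousComponent w' N (aeval f P) =
      aeval f (weightedHomogeneousComponent w N P) := by
  rw [eq_sum_smul_monomial P]
  simp only [map_sum, map_smul]
  refine Finset.sum_congr rfl fun d _ => ?_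
  congr 1
  have h1 := isWeightedHomogeneous_aeval_monomial hf d
  have h2 := isWeightedHomogeneous_monomial w d (1 : ℂ) rfl
  by_cases hN : N = Finsupp.weight w d
  · rw [hN, h1.weightedHomogeneousComponent_same, h2.weightedHomogeneousComponent_same]
  · rw [h1.weightedHomogeneousComponent_ne _ hN, h2.weightedHomogeneousComponent_ne _ hN, map_zero]

lemma eval_div_pow_of_isWeightedHomogeneous {w : σ → ℕ} {N : ℕ} {R : MvPolynomial σ ℂ}
    (hR : IsWeightedHomogeneous w R N) (a : σ → ℂ) (s : ℂ) :
    eval (fun v => a v / s ^ w v) R = eval a R / s ^ N := by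
  have h : aeval (fun v => C (s⁻¹ ^ w v) * X v : σ → MvPolynomial σ ℂ) R = C (s⁻¹ ^ N) * R := by
    ext d
    rw [coeff_aeval_scale, coeff_C_mul]
    by_cases hd : coeff d R = 0
    · rw [hd, mul_zero, mul_zero]
    · rw [hR hd]
  have h2 := congrArg (eval a) h
  rw [eval_aeval, map_mul, eval_C] at h2
  rw [div_eq_mul_inv, mul_comm, ← inv_pow, ← h2]
  refine congrArg (fun x => eval x R) (funext fun v => ?_)
  rw [map_mul, eval_C, eval_X, div_eq_mul_inv, mul_comm, inv_pow]

end Weights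

section Range

variable {p q : ℕ}

/-- The exponent of `f₁'` in the denominator of the coordinate of a normalized curve. -/
def denomWeight (v : MatVar p q) : ℕ := 2 * (matCol v : ℕ) + 3

lemma isWeightedHomogeneous_initMinor (r : ℕ) (hr : r ≤ p) (c : Fin r → Fin q) :
    IsWeightedHomogeneous denomWeight (initMinor r hr c) (∑ s, (2 * (c s : ℕ) + 3)) := by
  rw [initMinor_eq_sum]
  refine IsWeightedHomogeneous.sum _ _ _ fun σ _ => isWeightedHomogeneous_monomial _ _ _ ?_
  rw [pathExponent, map_sum]
  refine Eq.trans (Finset.sum_congr rfl fun t _ => ?_)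
    (Equiv.sum_comp σ fun s => 2 * (c s : ℕ) + 3)
  rw [Finsupp.weight_single, one_smul]
  rfl

lemma weightLE_sliceCoord (v : Fin (p + 1) × ℕ) :
    WeightLE (fun x : MatVar p q => (matCol x : ℕ) + 2) v.2 (sliceCoord v) := by
  obtain ⟨a, l⟩ := v
  refine Fin.cases ?_ (fun i => ?_) a
  · rw [sliceCoord_zero]
    split_ifs with h
    · exact fun d hd => (WeightLE.one _ d hd).trans (Nat.zero_le _)
    · exact fun d hd => absurd (coeff_zero d) hd
  · rw [sliceCoord_succ]
    split_ifs with h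
    · intro d hd
      refine (isWeightedHomogeneous_X ℂ _ _ hd).le.trans ?_
      simp
      omega
    · exact fun d hd => absurd (coeff_zero d) hd

/-- Since `κ (2 l - 1) ≤ (2 κ - 1) l` for `l ≤ κ`, a bound on the weighted degree bounds the
exponent of the denominator. -/
lemma mul_weight_denomWeight_le {κ m : ℕ} {d : MatVar p (κ - 1) →₀ ℕ}
    (hd : Finsupp.weight (fun x : MatVar p (κ - 1) => (matCol x : ℕ) + 2) d ≤ m) :
    κ * Finsupp.weight denomWeight d ≤ (2 * κ - 1) * m := by
  have key : ∀ x : ℕ, x + 2 ≤ κ → κ * (2 * x + 3) ≤ (2 * κ - 1) * (x + 2) := by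
    intro x hx
    obtain ⟨c, rfl⟩ := Nat.exists_eq_add_of_le hx
    rw [show 2 * (x + 2 + c) - 1 = 2 * x + 3 + 2 * c by omega]
    nlinarith [Nat.zero_le (c * x)]
  refine le_trans ?_ (Nat.mul_le_mul_left _ hd)
  rw [Finsupp.weight_eq_sum, Finsupp.weight_eq_sum, Finset.mul_sum, Finset.mul_sum]
  refine Finset.sum_le_sum fun v _ => ?_
  rw [smul_eq_mul, smul_eq_mul, mul_left_comm, mul_left_comm (2 * κ - 1)]
  have hv := (matCol v).2
  exact Nat.mul_le_mul_left _ (key _ (by omega))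

/-- The decomposition of a polynomial whose denominators are bounded as above. -/
lemma eq_sum_weightedHomogeneousComponent {κ m : ℕ} (hκ : 1 ≤ κ)
    {Q : MvPolynomial (MatVar p (κ - 1)) ℂ}
    (hQ : WeightLE (fun x : MatVar p (κ - 1) => (matCol x : ℕ) + 2) m Q) :
    Q = ∑ a ∈ Finset.Icc ⌈-(((κ : ℚ) - 1) / κ * m)⌉ (m : ℤ),
      weightedHomogeneousComponent denomWeight (m - a).toNat Q := by
  classical
  ext d
  rw [coeff_sum]
  simp only [coeff_weightedHomogeneousComponent]
  by_cases hd : coeff d Q = 0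
  · simp [hd]
  set W := Finsupp.weight denomWeight d with hW
  have hbound : κ * W ≤ (2 * κ - 1) * m := mul_weight_denomWeight_le (hQ d hd)
  rw [Finset.sum_eq_single ((m : ℤ) - W)]
  · rw [if_pos]
    simp
  · intro a ha hne
    rw [if_neg]
    intro h
    have := (Finset.mem_Icc.1 ha).2
    omega
  · intro h
    refine absurd (Finset.mem_Icc.2 ⟨Int.ceil_le.2 ?_, by omega⟩) h
    have hκ' : (0 : ℚ) < κ := by exact_mod_cast hκ
    have h1 : (κ : ℚ) * W ≤ (2 * κ - 1) * m := by
      have := (Nat.cast_le (α := ℚ)).2 hbound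
      rw [Nat.cast_mul, Nat.cast_mul, Nat.cast_sub (by omega)] at this
      exact_mod_cast this
    push_cast
    have h2 : (W : ℚ) ≤ (2 * κ - 1) * m / κ := by
      rw [le_div_iff₀ hκ']
      linarith
    have h3 : -(((κ : ℚ) - 1) / κ * m) = m - (2 * κ - 1) * m / κ := by
      field_simp
      ring
    rw [h3]
    linarith

end Range

/-! ### Return to the invariant -/

/-- An identity of Laurent polynomials in `f₁'` can be checked at the points where `f₁' ≠ 0`. -/
lemma algebraMap_eq_sum_of_eval {σ : Type*} (v : σ) (P : MvPolynomial σ ℂ) (s : Finset ℤ)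
    (R : ℤ → MvPolynomial σ ℂ)
    (h : ∀ z : σ → ℂ, z v ≠ 0 → eval z P = ∑ a ∈ s, z v ^ a * eval z (R a)) :
    algebraMap (MvPolynomial σ ℂ) (FractionRing (MvPolynomial σ ℂ)) P =
      ∑ a ∈ s, algebraMap (MvPolynomial σ ℂ) (FractionRing (MvPolynomial σ ℂ)) (X v) ^ a *
        algebraMap (MvPolynomial σ ℂ) (FractionRing (MvPolynomial σ ℂ)) (R a) := by
  obtain ⟨M, hM⟩ : ∃ M : ℕ, ∀ a ∈ s, 1 ≤ M + a := by
    refine ⟨∑ a ∈ s, (1 - a).toNat, fun a ha => ?_⟩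
    have h1 := Finset.single_le_sum (f := fun a : ℤ => (1 - a).toNat) (fun _ _ => Nat.zero_le _) ha
    omega
  have hpoly : X v ^ (M + 1) * P = ∑ a ∈ s, X v ^ ((M + 1 : ℕ) + a).toNat * R a := by
    refine MvPolynomial.funext fun z => ?_
    simp only [map_mul, map_pow, map_sum, eval_X]
    by_cases hz : z v = 0
    · rw [hz, zero_pow (Nat.succ_ne_zero M), zero_mul, Finset.sum_eq_zero]
      intro a ha
      have := hM a ha
      rw [zero_pow (by omega), zero_mul]
    · rw [h z hz, Finset.mul_sum]
      refine Finset.sum_congr rfl fun a ha => ?_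
      have := hM a ha
      rw [← mul_assoc, ← zpow_natCast, ← zpow_natCast, ← zpow_add₀ hz, Int.toNat_of_nonneg (by omega)]
  set K := FractionRing (MvPolynomial σ ℂ)
  have hX : algebraMap (MvPolynomial σ ℂ) K (X v) ≠ 0 := by
    rw [Ne, FaithfulSMul.algebraMap_eq_zero_iff]
    exact X_ne_zero v
  have h2 := congrArg (algebraMap (MvPolynomial σ ℂ) K) hpoly
  simp only [map_mul, map_pow, map_sum] at h2
  refine mul_left_cancel₀ (pow_ne_zero (M + 1) hX) (h2.trans ?_)
  rw [Finset.mul_sum]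
  refine Finset.sum_congr rfl fun a ha => ?_
  have := hM a ha
  rw [← mul_assoc, ← zpow_natCast, ← zpow_natCast, ← zpow_add₀ hX, Int.toNat_of_nonneg (by omega)]

lemma aeval_initMinor {p κ : ℕ} (μ : MinorIndex (p + 1) κ) :
    aeval (fun v : MatVar p (κ - 1) => initInv (matRow v).succ (matCol v : ℕ))
      (initMinor μ.1 (Nat.le_of_lt_succ μ.1.2) μ.2) = minor (p + 1) κ μ := by
  rw [initMinor, AlgHom.map_det, minor]
  congr 1
  ext s t : 2
  simp only [AlgHom.mapMatrix_apply, Matrix.map_apply, Matrix.of_apply, aeval_X, matRow_matVar,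
    matCol_matVar]
  rfl

end JetInvariants

open JetInvariants MvPolynomial in
theorem mainTheorem5 (n κ m : ℕ) [NeZero n] (hκ : 1 ≤ κ)
    (P : JetInvariants.JetPoly n) (hP : JetInvariants.IsBiInvariant n κ m P) :
    ∃ BP : ℤ → MvPolynomial (JetInvariants.MinorIndex n κ) ℂ,
      algebraMap (JetInvariants.JetPoly n) (FractionRing (JetInvariants.JetPoly n)) P =
        ∑ a ∈ Finset.Icc ⌈-(((κ : ℚ) - 1) / κ * m)⌉ (m : ℤ),
          algebraMap (JetInvariants.JetPoly n) (FractionRing (JetInvariants.JetPoly n))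
              (MvPolynomial.X (0, 1)) ^ a *
            algebraMap (JetInvariants.JetPoly n) (FractionRing (JetInvariants.JetPoly n))
              (MvPolynomial.aeval (JetInvariants.minor n κ) (BP a)) := by
  obtain ⟨p, rfl⟩ := Nat.exists_eq_succ_of_ne_zero (NeZero.ne n)
  let F : MinorIndex (p + 1) κ → MvPolynomial (MatVar p (κ - 1)) ℂ :=
    fun μ => initMinor μ.1 (Nat.le_of_lt_succ μ.1.2) μ.2
  let w : MinorIndex (p + 1) κ → ℕ := fun μ => ∑ s, (2 * (μ.2 s : ℕ) + 3)
  have hF : ∀ μ, IsWeightedHomogeneous denomWeight (F μ) (w μ) := fun μ =>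
    isWeightedHomogeneous_initMinor _ _ _
  set Q : MvPolynomial (MatVar p (κ - 1)) ℂ := aeval sliceCoord P with hQ
  obtain ⟨B, hB⟩ : ∃ B, aeval F B = Q := by
    have hle : Algebra.adjoin ℂ {G | ∃ (r : ℕ) (hr : r ≤ p) (c : Fin r → Fin (κ - 1)),
        G = initMinor r hr c} ≤ (aeval F : MvPolynomial (MinorIndex (p + 1) κ) ℂ →ₐ[ℂ] _).range := by
      rw [Algebra.adjoin_le_iff]
      rintro _ ⟨r, hr, c, rfl⟩
      exact ⟨X ⟨⟨r, Nat.lt_succ_of_le hr⟩, c⟩, aeval_X _ _⟩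
    exact hle (mem_adjoin_initMinor fun i j hij t =>
      rowAdd_aeval_sliceCoord hP.unipotent (Fin.lt_def.2 (by omega)) t)
  refine ⟨fun a => weightedHomogeneousComponent w (m - a).toNat B, ?_⟩
  refine algebraMap_eq_sum_of_eval (0, 1) P _ _ fun z hz => ?_
  rw [hP.reparam.eval_eq_mul_eval_normalizedJet hP.order z hz,
    eval_normalizedJet hP.order hP.unipotent,
    eq_sum_weightedHomogeneousComponent hκ
      (WeightLE.aeval weightLE_sliceCoord hP.reparam.isWeightedHomogeneous : WeightLE _ m Q),
    map_sum, Finset.mul_sum]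
  refine Finset.sum_congr rfl fun a ha => ?_
  have hval : eval (fun v : MatVar p (κ - 1) => eval z (initInv (matRow v).succ (matCol v : ℕ)))
      (weightedHomogeneousComponent denomWeight (m - a).toNat Q) =
      eval z (aeval (minor (p + 1) κ) (weightedHomogeneousComponent w (m - a).toNat B)) := by
    rw [← hB, weightedHomogeneousComponent_aeval hF, eval_aeval, eval_aeval]
    refine congrArg (fun x => eval x _) (funext fun μ => ?_)
    rw [← aeval_initMinor, eval_aeval]
  have hsub := eval_div_pow_of_isWeightedHomogeneous
    (weightedHomogeneousComponent_isWeightedHomogeneous (w := denomWeight) (m - a).toNat Q)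
    (fun v : MatVar p (κ - 1) => eval z (initInv (matRow v).succ (matCol v : ℕ))) (z (0, 1))
  rw [hval] at hsub
  refine (congrArg _ hsub).trans ?_
  have ham := (Finset.mem_Icc.1 ha).2
  rw [mul_div_assoc', mul_div_right_comm]
  congr 1
  rw [← zpow_natCast, ← zpow_natCast, ← zpow_sub₀ hz, Int.toNat_of_nonneg (by omega)]
  congr 1
  omega
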